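/- Conventions. A group is hyperbolic if it has a finite generating set whose word metric is Gromov hyperbolic. A graph is a non-empty connected graph (loops and multiple edges allowed), regarded as a geodesic metric space in which every edge has length $1$; a group acts on it by graph automorphisms. An action of a (discrete) group $G$ on a metric space $X$ is proper if for all compact $K,L\subseteq X$ the set $\{g\in G: gK\cap L\neq\emptyset\}$ is finite, and cocompact if $X=\bigcup_{g\in G}gK$ for some compact $K\subseteq X$. Let $X$ be a geodesic metric space. For $\theta\ge 0$, a $\theta$-cylinder of $x,y\in X$ is a subset $C\subseteq X$ such that $[x,y]\subseteq C\subseteq N_\theta([x,y])$ for every geodesic $[x,y]$ from $x$ to $y$, where $N_\theta$ denotes the closed $\theta$-neighbourhood. A choice of a $\theta$-cylinder $C(x,y)$ for every $x,y\in X$ is called globally stable if $C(x,y)=C(y,x)$ for all $x,y\in X$, and there are an integer $k\ge0$ and a real $R\ge 0$ such that for all $x,y,z\in X$ there are $k$ closed balls $B_1,\dots,B_k$ of radius $R$ in $X$ with $$\bigl(C(x,y)\cap B(x,\rho)\bigr)\setminus\bigcup_{i=1}^kB_i=\bigl(C(x,z)\cap B(x,\rho)\bigr)\setminus\bigcup_{i=1}^kB_i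 ,\qquad \rho=\tfrac12\bigl(d(x,y)+d(x,z)-d(y,z)\bigr),$$ where $B(x,\rho)$ is the closed ball. If $G$ acts on $X$ by isometries, the choice is $G$-invariant if $C(gx,gy)=gC(x,y)$ for all $g\in G$ and $x,y\in X$. One says that $X$ admits $G$-invariant globally stable cylinders if such a choice exists for some $\theta\ge0$, and that a group $G$ admits globally stable cylinders if some non-empty geodesic Gromov hyperbolic metric space with a proper cocompact isometric action of $G$ admits $G$-invariant globally stable cylinders. Proposition. Let $G$ be a hyperbolic group. (1) Let $X,X'$ be graphs on which $G$ acts properly and cocompactly. Then $X$ admits $G$-invariant globally stable cylinders if and only if $X'$ does. (2) Admitting globally stable cylinders is a property of the group, independent of the space: for every non-empty geodesic metric space $X$ on which $G$ acts properly and cocompactly by isometries, $G$ admits globally stable cylinders if and only if $X$ admits $G$-invariant globally stable cylinders. -/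

import Mathlib

open scoped Pointwise

universe u v w

/-! ### Gromov hyperbolicity -/

/-- Gromov's four-point condition, for some constant `δ`, for a distance function `d`. -/
def FourPointHyperbolic {α : Type u} (d : α → α → ℝ) : Prop :=
  ∃ δ : ℝ, ∀ x y z t : α,
    d x y + d z t ≤ max (d x z + d y t) (d x t + d y z) + 2 * δ

/-- A group is hyperbolic if it has a finite generating set whose word metric
(the vertex metric of the Cayley graph) is Gromov hyperbolic. -/
def IsHyperbolicGroup (G : Type u) [Group G] : Prop :=
  ∃ S : Finset G, Subgroup.closure (S : Set G) = ⊤ ∧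
    FourPointHyperbolic fun a b : G =>
      ((SimpleGraph.mulCayley (S : Set G)).dist a b : ℝ)

/-! ### Geodesics and group actions -/

section MetricNotions

variable {X : Type u} [MetricSpace X]

/-- `s` is (the image of) a geodesic segment from `x` to `y`. -/
def IsGeodesicSegment (x y : X) (s : Set X) : Prop :=
  ∃ γ : ℝ → X, γ 0 = x ∧ γ (dist x y) = y ∧
    (∀ a ∈ Set.Icc 0 (dist x y), ∀ b ∈ Set.Icc 0 (dist x y), dist (γ a) (γ b) = |a - b|) ∧
    s = γ '' Set.Icc 0 (dist x y)

/-- Every two points are joined by a geodesic segment. -/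
def IsGeodesicSpace (X : Type u) [MetricSpace X] : Prop :=
  ∀ x y : X, ∃ s : Set X, IsGeodesicSegment x y s

/-- The action is cocompact: the translates of some compact set cover the space. -/
def IsCocompactAction (G : Type v) (X : Type u) [Group G] [MetricSpace X] [MulAction G X] : Prop :=
  ∃ K : Set X, IsCompact K ∧ (⋃ g : G, g • K) = Set.univ

/-! ### Globally stable cylinders -/

/-- The Gromov product `(y.z)_x`. -/
noncomputable def gromovProduct (x y z : X) : ℝ :=
  (dist x y + dist x z - dist y z) / 2

/-- `C` is a `θ`-cylinder of `x, y`. -/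
def IsCylinder (θ : ℝ) (x y : X) (C : Set X) : Prop :=
  ∀ s : Set X, IsGeodesicSegment x y s → s ⊆ C ∧ C ⊆ Metric.cthickening θ s

/-- `(k, R)`-stability of a choice of cylinders. -/
def IsStable (k : ℕ) (R : ℝ) (C : X → X → Set X) : Prop :=
  ∀ x y z : X, ∃ c : Fin k → X,
    (C x y ∩ Metric.closedBall x (gromovProduct x y z)) \ (⋃ i, Metric.closedBall (c i) R) =
      (C x z ∩ Metric.closedBall x (gromovProduct x y z)) \ (⋃ i, Metric.closedBall (c i) R)

/-- A choice of `θ`-cylinders that is globally stable. -/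
def IsGloballyStable (θ : ℝ) (C : X → X → Set X) : Prop :=
  (∀ x y, IsCylinder θ x y (C x y)) ∧
    (∀ x y, C x y = C y x) ∧
    ∃ (k : ℕ) (R : ℝ), 0 ≤ R ∧ IsStable k R C

end MetricNotions

/-- `X` admits `G`-invariant globally stable cylinders. -/
def AdmitsInvariantStableCylinders (G : Type v) (X : Type u) [Group G] [MetricSpace X]
    [MulAction G X] : Prop :=
  ∃ θ : ℝ, 0 ≤ θ ∧ ∃ C : X → X → Set X, IsGloballyStable θ C ∧
    ∀ (g : G) (x y : X), C (g • x) (g • y) = g • C x y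

/-- The group `G` admits globally stable cylinders: some (non-empty) geodesic hyperbolic space with
a proper cocompact isometric action of `G` admits `G`-invariant ones. -/
def GroupAdmitsStableCylinders (G : Type v) [Group G] : Prop :=
  ∃ (X : Type u) (_ : MetricSpace X) (_ : MulAction G X),
    IsIsometricSMul G X ∧ Nonempty X ∧ IsGeodesicSpace X ∧
    FourPointHyperbolic (fun x y : X => dist x y) ∧
    ProperlyDiscontinuousSMul G X ∧ IsCocompactAction G X ∧
    AdmitsInvariantStableCylinders G X

/-! ### Graphs and their geometric realizations -/

/-- A connected graph, loops and multiple edges allowed: every edge is a pair of opposite darts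
(oriented edges) `d`, `rev d`; the dart `d` runs from `src d` to `src (rev d)`. -/
structure ConnectedGraph where
  V : Type u
  D : Type u
  src : D → V
  rev : D → D
  rev_rev : ∀ d, rev (rev d) = d
  rev_ne : ∀ d, rev d ≠ d
  connected : (SimpleGraph.fromRel fun a b => ∃ d, src d = a ∧ src (rev d) = b).Connected

/-- An action of a group on a graph by graph automorphisms (edge inversions allowed). -/
class GraphAction (G : Type v) [Group G] (Γ : ConnectedGraph.{u}) where
  [actV : MulAction G Γ.V]
  [actD : MulAction G Γ.D]
  src_smul : ∀ (g : G) (d : Γ.D), Γ.src (g • d) = g • Γ.src d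
  rev_smul : ∀ (g : G) (d : Γ.D), Γ.rev (g • d) = g • Γ.rev d

attribute [reducible, instance] GraphAction.actV GraphAction.actD

namespace ConnectedGraph

variable (Γ : ConnectedGraph.{u})

/-- The underlying simple graph, which determines the combinatorial distance of vertices. -/
def simple : SimpleGraph Γ.V :=
  SimpleGraph.fromRel fun a b => ∃ d, Γ.src d = a ∧ Γ.src (Γ.rev d) = b

/-- Names for the points of the geometric realization: vertices, and the point at position `t`
along a dart `d`. A point may have several names. -/
inductive PrePoint : Type u
  | vert (a : Γ.V) : PrePoint
  | pt (d : Γ.D) (t : unitInterval) : PrePoint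

variable {Γ}

/-- The distance from a point to a vertex. -/
noncomputable def toVertex : Γ.PrePoint → Γ.V → ℝ
  | .vert a, b => Γ.simple.dist a b
  | .pt d t, b => min ((t : ℝ) + Γ.simple.dist (Γ.src d) b)
      (1 - (t : ℝ) + Γ.simple.dist (Γ.src (Γ.rev d)) b)

/-- `AlongEdge p q l`: `p` and `q` lie on a common edge and the subsegment of this edge between
them has length `l`. -/
inductive AlongEdge : Γ.PrePoint → Γ.PrePoint → ℝ → Prop
  | same (d : Γ.D) (s t : unitInterval) : AlongEdge (.pt d s) (.pt d t) |(s : ℝ) - t|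
  | opp (d : Γ.D) (s t : unitInterval) :
      AlongEdge (.pt d s) (.pt (Γ.rev d) t) |(s : ℝ) - (1 - t)|

/-- The path metric on the geometric realization in which all edges have length one: a shortest
path either stays inside one edge or passes through a vertex. -/
noncomputable def preDist (p q : Γ.PrePoint) : ℝ :=
  sInf {l | AlongEdge p q l ∨ ∃ a : Γ.V, l = toVertex p a + toVertex q a}

theorem simple_connected : Γ.simple.Connected := Γ.connected

theorem toVertex_nonneg (p : Γ.PrePoint) (a : Γ.V) : 0 ≤ toVertex p a := by
  cases p with
  | vert b => exact Nat.cast_nonneg _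
  | pt d t =>
    have h0 := t.2.1
    have h1 := t.2.2
    exact le_min (by positivity) (add_nonneg (by linarith) (by positivity))

theorem AlongEdge.nonneg {p q : Γ.PrePoint} {l : ℝ} (h : AlongEdge p q l) : 0 ≤ l := by
  cases h <;> exact abs_nonneg _

theorem AlongEdge.symm {p q : Γ.PrePoint} {l : ℝ} (h : AlongEdge p q l) : AlongEdge q p l := by
  cases h with
  | same d s t => rw [abs_sub_comm]; exact .same d t s
  | opp d s t =>
    have h := AlongEdge.opp (Γ.rev d) t s
    rw [Γ.rev_rev] at h
    convert h using 1
    rw [abs_sub_comm, ← abs_neg]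
    congr 1
    ring

theorem AlongEdge.trans {p q r : Γ.PrePoint} {l m : ℝ} (h : AlongEdge p q l)
    (h' : AlongEdge q r m) : ∃ n ≤ l + m, AlongEdge p r n := by
  cases h with
  | same d s t =>
    cases h' with
    | same _ _ x => exact ⟨_, abs_sub_le _ _ _, .same d s x⟩
    | opp _ _ x => exact ⟨_, abs_sub_le _ _ _, .opp d s x⟩
  | opp d s t =>
    cases h' with
    | same _ _ x =>
      refine ⟨_, ?_, .opp d s x⟩
      have := abs_sub_le (s : ℝ) (1 - t) (1 - x)
      rw [show (1 - (t : ℝ)) - (1 - x) = -(t - x) by ring, abs_neg] at this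
      exact this
    | opp _ _ x =>
      rw [Γ.rev_rev]
      refine ⟨_, ?_, .same d s x⟩
      have := abs_sub_le (s : ℝ) (1 - t) x
      rw [show (1 - (t : ℝ)) - x = -(t - (1 - x)) by ring, abs_neg] at this
      exact this

theorem AlongEdge.toVertex_le {p q : Γ.PrePoint} {l : ℝ} (h : AlongEdge p q l) (a : Γ.V) :
    toVertex p a ≤ l + toVertex q a := by
  cases h with
  | same d s t =>
    have h1 := le_abs_self ((s : ℝ) - t)
    have h2 := neg_abs_le ((s : ℝ) - t)
    simp only [toVertex]
    rw [← min_add_add_left]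
    exact min_le_min (by linarith) (by linarith)
  | opp d s t =>
    have h1 := le_abs_self ((s : ℝ) - (1 - t))
    have h2 := neg_abs_le ((s : ℝ) - (1 - t))
    simp only [toVertex, Γ.rev_rev]
    rw [← min_add_add_left, min_comm]
    exact min_le_min (by linarith) (by linarith)

theorem cast_dist_triangle (a b c : Γ.V) :
    (Γ.simple.dist a c : ℝ) ≤ Γ.simple.dist a b + Γ.simple.dist b c := by
  exact_mod_cast simple_connected.dist_triangle

theorem toVertex_le_add (p : Γ.PrePoint) (a b : Γ.V) :
    toVertex p b ≤ toVertex p a + Γ.simple.dist a b := by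
  cases p with
  | vert c => exact cast_dist_triangle c a b
  | pt d t =>
    have h1 := cast_dist_triangle (Γ.src d) a b
    have h2 := cast_dist_triangle (Γ.src (Γ.rev d)) a b
    simp only [toVertex]
    rw [← min_add_add_right]
    exact min_le_min (by linarith) (by linarith)

theorem dist_src_le (d : Γ.D) : (Γ.simple.dist (Γ.src d) (Γ.src (Γ.rev d)) : ℝ) ≤ 1 := by
  by_cases h : Γ.src d = Γ.src (Γ.rev d)
  · rw [← h, SimpleGraph.dist_self]; simp
  · have : Γ.simple.Adj (Γ.src d) (Γ.src (Γ.rev d)) := by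
      rw [simple, SimpleGraph.fromRel_adj]
      exact ⟨h, Or.inl ⟨d, rfl, rfl⟩⟩
    rw [SimpleGraph.dist_eq_one_iff_adj.2 this]; simp

theorem dist_le_toVertex_add (p : Γ.PrePoint) (a b : Γ.V) :
    (Γ.simple.dist a b : ℝ) ≤ toVertex p a + toVertex p b := by
  cases p with
  | vert c =>
    have h := cast_dist_triangle a c b
    rw [Γ.simple.dist_comm (u := a) (v := c)] at h
    exact h
  | pt d t =>
    have h0 := t.2.1
    have h1 := t.2.2
    have hd := dist_src_le d
    have e1 := cast_dist_triangle a (Γ.src d) b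
    have e2 := cast_dist_triangle a (Γ.src (Γ.rev d)) b
    have e3 := cast_dist_triangle (Γ.src d) (Γ.src (Γ.rev d)) b
    have e4 := cast_dist_triangle (Γ.src d) (Γ.src (Γ.rev d)) a
    rw [Γ.simple.dist_comm (u := a) (v := Γ.src d)] at e1
    rw [Γ.simple.dist_comm (u := a) (v := Γ.src (Γ.rev d))] at e2
    simp only [toVertex]
    rcases min_choice ((t : ℝ) + Γ.simple.dist (Γ.src d) a)
      (1 - (t : ℝ) + Γ.simple.dist (Γ.src (Γ.rev d)) a) with h | h <;>
    rcases min_choice ((t : ℝ) + Γ.simple.dist (Γ.src d) b)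
      (1 - (t : ℝ) + Γ.simple.dist (Γ.src (Γ.rev d)) b) with h' | h' <;>
    rw [h, h'] <;> linarith

theorem preDist_le_of_alongEdge {p q : Γ.PrePoint} {l : ℝ} (h : AlongEdge p q l) :
    preDist p q ≤ l := by
  refine csInf_le ⟨0, ?_⟩ (Or.inl h)
  rintro _ (h | ⟨a, rfl⟩)
  · exact h.nonneg
  · exact add_nonneg (toVertex_nonneg _ _) (toVertex_nonneg _ _)

theorem preDist_le_toVertex (p q : Γ.PrePoint) (a : Γ.V) :
    preDist p q ≤ toVertex p a + toVertex q a := by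
  refine csInf_le ⟨0, ?_⟩ (Or.inr ⟨a, rfl⟩)
  rintro _ (h | ⟨a, rfl⟩)
  · exact h.nonneg
  · exact add_nonneg (toVertex_nonneg _ _) (toVertex_nonneg _ _)

theorem le_preDist {p q : Γ.PrePoint} {c : ℝ} (h1 : ∀ l, AlongEdge p q l → c ≤ l)
    (h2 : ∀ a, c ≤ toVertex p a + toVertex q a) : c ≤ preDist p q := by
  obtain ⟨a⟩ := (simple_connected (Γ := Γ)).nonempty
  refine le_csInf ⟨_, Or.inr ⟨a, rfl⟩⟩ ?_
  rintro _ (h | ⟨a, rfl⟩)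
  · exact h1 _ h
  · exact h2 a

theorem preDist_nonneg (p q : Γ.PrePoint) : 0 ≤ preDist p q :=
  le_preDist (fun _ h => h.nonneg) fun _ => add_nonneg (toVertex_nonneg _ _) (toVertex_nonneg _ _)

theorem preDist_self (p : Γ.PrePoint) : preDist p p = 0 := by
  refine le_antisymm ?_ (preDist_nonneg p p)
  cases p with
  | vert a =>
    have h := preDist_le_toVertex (.vert a : Γ.PrePoint) (.vert a) a
    simpa [toVertex] using h
  | pt d t => simpa using preDist_le_of_alongEdge (AlongEdge.same d t t)

theorem preDist_comm (p q : Γ.PrePoint) : preDist p q = preDist q p := by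
  have key : ∀ p q : Γ.PrePoint, preDist p q ≤ preDist q p := fun p q =>
    le_preDist (fun _ h => preDist_le_of_alongEdge h.symm) fun a => by
      rw [add_comm]; exact preDist_le_toVertex p q a
  exact le_antisymm (key p q) (key q p)

theorem preDist_triangle (p q r : Γ.PrePoint) : preDist p r ≤ preDist p q + preDist q r := by
  rw [← sub_le_iff_le_add]
  refine le_preDist (fun l hl => ?_) fun a => ?_ <;>
  rw [sub_le_iff_le_add, ← sub_le_iff_le_add'] <;>
  refine le_preDist (fun m hm => ?_) fun b => ?_
  · obtain ⟨n, hn, h⟩ := hl.trans hm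
    linarith [preDist_le_of_alongEdge h]
  · linarith [preDist_le_toVertex p r b, hl.toVertex_le b]
  · linarith [preDist_le_toVertex p r a, hm.symm.toVertex_le a]
  · linarith [preDist_le_toVertex p r b, toVertex_le_add p a b, dist_le_toVertex_add q a b]

noncomputable instance : PseudoMetricSpace Γ.PrePoint where
  dist := preDist
  dist_self := preDist_self
  dist_comm := preDist_comm
  dist_triangle := preDist_triangle

variable (Γ) in
/-- The geometric realization of the graph, a metric space in which every edge has length one:
names of points at distance zero are identified. -/
abbrev Realization : Type u := SeparationQuotient Γ.PrePoint

section Action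

variable {G : Type v} [Group G] [GraphAction G Γ]

/-- The action on the realization, affine on the edges. -/
instance : MulAction G Γ.PrePoint where
  smul g p := match p with
    | .vert a => .vert (g • a)
    | .pt d t => .pt (g • d) t
  one_smul p := by
    cases p with
    | vert a => exact congrArg PrePoint.vert (one_smul G a)
    | pt d t => exact congrArg (PrePoint.pt · t) (one_smul G d)
  mul_smul g h p := by
    cases p with
    | vert a => exact congrArg PrePoint.vert (mul_smul g h a)
    | pt d t => exact congrArg (PrePoint.pt · t) (mul_smul g h d)

theorem smul_vert (g : G) (a : Γ.V) : g • (.vert a : Γ.PrePoint) = .vert (g • a) := rfl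

theorem smul_pt (g : G) (d : Γ.D) (t : unitInterval) :
    g • (.pt d t : Γ.PrePoint) = .pt (g • d) t := rfl

theorem adj_smul (g : G) {a b : Γ.V} (h : Γ.simple.Adj a b) :
    Γ.simple.Adj (g • a) (g • b) := by
  rw [simple, SimpleGraph.fromRel_adj] at h ⊢
  refine ⟨fun e => h.1 (MulAction.injective g e), ?_⟩
  rcases h.2 with ⟨d, rfl, rfl⟩ | ⟨d, rfl, rfl⟩
  · exact Or.inl ⟨g • d, GraphAction.src_smul g d, by
      rw [GraphAction.rev_smul, GraphAction.src_smul]⟩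
  · exact Or.inr ⟨g • d, GraphAction.src_smul g d, by
      rw [GraphAction.rev_smul, GraphAction.src_smul]⟩

theorem dist_smul_le (g : G) (a b : Γ.V) :
    Γ.simple.dist (g • a) (g • b) ≤ Γ.simple.dist a b := by
  obtain ⟨w, hw⟩ := simple_connected.exists_walk_length_eq_dist a b
  let f : Γ.simple →g Γ.simple := ⟨fun c => g • c, fun h => adj_smul g h⟩
  rw [← hw, ← SimpleGraph.Walk.length_map f w]
  exact SimpleGraph.dist_le _

theorem dist_smul_vertex (g : G) (a b : Γ.V) :
    Γ.simple.dist (g • a) (g • b) = Γ.simple.dist a b := by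
  refine le_antisymm (dist_smul_le g a b) ?_
  simpa using dist_smul_le g⁻¹ (g • a) (g • b)

theorem toVertex_smul (g : G) (p : Γ.PrePoint) (a : Γ.V) :
    toVertex (g • p) (g • a) = toVertex p a := by
  cases p with
  | vert b => simp only [smul_vert, toVertex, dist_smul_vertex]
  | pt d t =>
    simp only [smul_pt, toVertex, GraphAction.src_smul, GraphAction.rev_smul, dist_smul_vertex]

theorem AlongEdge.smul (g : G) {p q : Γ.PrePoint} {l : ℝ} (h : AlongEdge p q l) :
    AlongEdge (g • p) (g • q) l := by
  cases h with
  | same d s t => exact .same (g • d) s t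
  | opp d s t =>
    rw [smul_pt, smul_pt, ← GraphAction.rev_smul]
    exact .opp (g • d) s t

theorem preDist_smul_le (g : G) (p q : Γ.PrePoint) : preDist (g • p) (g • q) ≤ preDist p q :=
  le_preDist (fun _ h => preDist_le_of_alongEdge (h.smul g)) fun a => by
    rw [← toVertex_smul g p a, ← toVertex_smul g q a]
    exact preDist_le_toVertex _ _ _

instance : IsIsometricSMul G Γ.PrePoint where
  isometry_smul g := Isometry.of_dist_eq fun p q => by
    refine le_antisymm (preDist_smul_le g p q) ?_
    have h := preDist_smul_le g⁻¹ (g • p) (g • q)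
    rwa [inv_smul_smul, inv_smul_smul] at h

instance : IsIsometricSMul G Γ.Realization where
  isometry_smul g := Isometry.of_dist_eq fun p q => by
    obtain ⟨p, rfl⟩ := SeparationQuotient.surjective_mk p
    obtain ⟨q, rfl⟩ := SeparationQuotient.surjective_mk q
    rw [← SeparationQuotient.mk_smul, ← SeparationQuotient.mk_smul, SeparationQuotient.dist_mk,
      SeparationQuotient.dist_mk, dist_smul]

end Action

end ConnectedGraph

/-!
Let a hyperbolic group `G` act properly and cocompactly on geodesic spaces `X` and `X'`. Graphs are
geodesic spaces (`ConnectedGraph.isGeodesicSpace_realization`), so both parts follow once invariant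
globally stable cylinders can be moved from `X` to `X'`.

By a Milnor–Schwarz argument (`exists_displacementControlsLength`) the correspondence
`g • x₀ ↔ g • x₀'` of two orbits is a quasi-isometry, and only finitely many elements of `G` move
`x₀'` by a bounded distance. Given cylinders `C` in `X`, the cylinder of `x', y'` in `X'` is the
union of the images of `C (g • x₀) (h • x₀)` under this correspondence, over all `g` and `h` for
which `g • x₀'` and `h • x₀'` are close to `x'` and `y'` (`transferredCylinder`). Taking all such
`g`, `h` keeps the construction equivariant; their number is bounded, so stability costs only a
bounded factor in the number of balls.

What remains is to compare betweenness in the two spaces, that is, boundedness of Gromov products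
`(a.b)_p`. The Morse lemma `IsQIEmbedding.gromovProduct_le` says that quasi-isometric embeddings of
geodesic spaces into hyperbolic spaces preserve it, and `IsQIEmbedding.exists_mem_dist_le` that it
amounts to closeness to geodesics. This shows that the new sets are cylinders. For stability, a
point of the new cylinder of `x', y'` in the ball around `x'` of radius `(y'.z')_{x'}` is almost
between `x'` and `z'` too, so the corresponding point `p` of `X` is almost between `x` and `z`. Then
`p` lies in the ball around `x` of radius `(y.z)_x`, where the stability of `C` applies, or just
outside of this ball, in which case it is in one further ball of bounded radius
(`IsCylinder.exists_centre`).

The Morse lemma is proved without geodesics in the target `Y`. For small `ε`, the function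
`exp (-ε (x.y)_p)` is subadditive along chains up to a factor `2`, by Frink's metrization lemma. Let
`f p` lie on a quasi-geodesic from `f a` to `f b`, and put `N = (f a.f b)_{f p}`. On either side
of `f p`, consider the last point, going outwards, at distance about `N` from `f p`. Summing along
the rest of the path shows that its Gromov product with the end point is at least `(1 - η) N - C`.
The two points so obtained are therefore at distance at most `2 η N + C`. But `f p` lies between
them on the quasi-geodesic, at distance about `N` from both, so `N` is bounded if `η` is small.

Finally, hyperbolicity of `X` follows from that of the word metric on `G`, since the Morse lemma
makes triangles in `X` thin (`IsQIEmbedding.fourPointHyperbolic`).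
-/

/-! ### Gromov products in hyperbolic spaces -/

section GromovProduct

variable {X : Type u} [MetricSpace X]

/-- Gromov's four-point condition for a metric space, with a given constant. -/
def FourPointWith (X : Type u) [MetricSpace X] (δ : ℝ) : Prop :=
  ∀ x y z t : X, dist x y + dist z t ≤ max (dist x z + dist y t) (dist x t + dist y z) + 2 * δ

theorem gromovProduct_comm (p x y : X) : gromovProduct p x y = gromovProduct p y x := by
  simp only [gromovProduct, dist_comm x y]; ring

theorem gromovProduct_nonneg (p x y : X) : 0 ≤ gromovProduct p x y := by
  have := dist_triangle_left x y p
  simp only [gromovProduct]; linarith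

theorem gromovProduct_le_dist (p x y : X) : gromovProduct p x y ≤ dist p x := by
  have := dist_triangle p x y
  simp only [gromovProduct]; linarith

/-- The Gromov product is `1`-Lipschitz in each of its three arguments. -/
theorem gromovProduct_le_add (p x y p' x' y' : X) :
    gromovProduct p x y ≤ gromovProduct p' x' y' + dist p p' + dist x x' + dist y y' := by
  have h1 := dist_triangle4 p p' x' x
  have h2 := dist_triangle4 p p' y' y
  have h3 := dist_triangle4 x' x y y'
  rw [dist_comm x' x] at h1 h3
  rw [dist_comm y' y] at h2
  simp only [gromovProduct]; linarith

theorem FourPointWith.min_le {δ : ℝ} (h : FourPointWith X δ) (p x y z : X) :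
    min (gromovProduct p x y) (gromovProduct p y z) ≤ gromovProduct p x z + δ := by
  have := h x z p y
  rw [dist_comm x p, dist_comm z y, dist_comm z p] at this
  simp only [gromovProduct]
  rcases le_total (dist p x + dist y z) (dist x y + dist p z) with h' | h'
  · rw [max_eq_right h'] at this
    exact (min_le_left _ _).trans (by linarith)
  · rw [max_eq_left h'] at this
    exact (min_le_right _ _).trans (by linarith)

/-- The function `exp (-ε (x.y)_p)` is almost an ultrametric. For small `ε`, Frink's metrization
lemma therefore bounds it by the sum of its values along any chain from `x` to `y`. -/
theorem FourPointWith.exp_gromovProduct_le_sum {δ ε : ℝ} (h : FourPointWith X δ) (hε : 0 < ε)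
    (hδ : 2 * (ε * δ) ≤ Real.log 2) (p : X) (y : ℕ → X) {m n : ℕ} (hmn : m ≤ n)
    (hne : y m ≠ y n) :
    Real.exp (-(ε * gromovProduct p (y m) (y n))) ≤
      2 * ∑ i ∈ Finset.Ico m n, Real.exp (-(ε * gromovProduct p (y i) (y (i + 1)))) := by
  classical
  set e : X → X → NNReal := fun a b => ⟨Real.exp (-(ε * gromovProduct p a b)), (Real.exp_pos _).le⟩
    with he
  set d : X → X → NNReal := fun a b => if a = b then 0 else e a b with hd
  have hde : ∀ a b, d a b ≤ e a b := fun a b => by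
    simp only [hd]; split_ifs
    · exact zero_le
    · exact le_rfl
  have d_self : ∀ a, d a a = 0 := fun a => by simp [hd]
  have d_comm : ∀ a b, d a b = d b a := fun a b => by
    simp only [hd, he, eq_comm (a := a), gromovProduct_comm p a b]
  set s : NNReal := ⟨Real.exp (ε * δ), (Real.exp_pos _).le⟩ with hs
  have hδ0 : 0 ≤ δ := by
    have := h p p p p
    simp only [dist_self, add_zero, max_self] at this
    linarith
  have hs1 : 1 ≤ s := by
    rw [← NNReal.coe_le_coe]
    exact Real.one_le_exp (by positivity)
  have hss : s * s ≤ 2 := by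
    rw [← NNReal.coe_le_coe]
    change Real.exp (ε * δ) * Real.exp (ε * δ) ≤ 2
    rw [← Real.exp_add, ← Real.le_log_iff_exp_le two_pos]
    linarith
  have e3 : ∀ a b c, e a c ≤ s * max (e a b) (e b c) := fun a b c => by
    have h1 := h.min_le p a b c
    rcases min_choice (gromovProduct p a b) (gromovProduct p b c) with h2 | h2 <;> rw [h2] at h1
    · refine le_trans ?_ (mul_le_mul_right (le_max_left _ _) s)
      rw [← NNReal.coe_le_coe]
      change Real.exp _ ≤ Real.exp _ * Real.exp _
      rw [← Real.exp_add, Real.exp_le_exp]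
      nlinarith
    · refine le_trans ?_ (mul_le_mul_right (le_max_right _ _) s)
      rw [← NNReal.coe_le_coe]
      change Real.exp _ ≤ Real.exp _ * Real.exp _
      rw [← Real.exp_add, Real.exp_le_exp]
      nlinarith
  have d3 : ∀ a b c, d a c ≤ s * max (d a b) (d b c) := fun a b c => by
    by_cases hac : a = c
    · subst hac; simp [d_self]
    by_cases hab : a = b
    · subst hab
      exact (le_max_right _ _).trans (le_mul_of_one_le_left zero_le hs1)
    by_cases hbc : b = c
    · subst hbc
      exact (le_max_left _ _).trans (le_mul_of_one_le_left zero_le hs1)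
    simpa only [hd, if_neg hac, if_neg hab, if_neg hbc] using e3 a b c
  have d4 : ∀ x₁ x₂ x₃ x₄, d x₁ x₄ ≤ 2 * max (d x₁ x₂) (max (d x₂ x₃) (d x₃ x₄)) := by
    intro x₁ x₂ x₃ x₄
    calc d x₁ x₄ ≤ s * max (d x₁ x₂) (d x₂ x₄) := d3 _ _ _
      _ ≤ s * max (s * d x₁ x₂) (s * max (d x₂ x₃) (d x₃ x₄)) :=
          mul_le_mul_right (max_le_max (le_mul_of_one_le_left zero_le hs1) (d3 _ _ _)) s
      _ = s * s * max (d x₁ x₂) (max (d x₂ x₃) (d x₃ x₄)) := by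
          rw [← mul_max_of_nonneg _ _ (zero_le : 0 ≤ s), mul_assoc]
      _ ≤ _ := mul_le_mul_left hss _
  let _ := PseudoMetricSpace.ofPreNNDist d d_self d_comm
  have key := PseudoMetricSpace.le_two_mul_dist_ofPreNNDist d d_self d_comm d4 (y m) (y n)
  have hmn' : (d (y m) (y n) : ℝ) = Real.exp (-(ε * gromovProduct p (y m) (y n))) := by
    rw [show d (y m) (y n) = e (y m) (y n) from if_neg hne]; rfl
  rw [← hmn']
  refine key.trans (mul_le_mul_of_nonneg_left ?_ two_pos.le)
  refine (dist_le_Ico_sum_dist y hmn).trans (Finset.sum_le_sum fun i _ => ?_)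
  exact (PseudoMetricSpace.dist_ofPreNNDist_le d d_self d_comm _ _).trans (hde _ _)

/-- Consider a discrete path `y 0, …, y n` in a hyperbolic space that moves away from `y 0` at
linear speed. Where such a path is at distance about `N` from `y 0` for the last time, it is, up to
a small multiple of `N`, on the way from `y 0` to its end point `y n`. -/
theorem FourPointWith.exists_gromovProduct_ge {δ : ℝ} (h : FourPointWith X δ) {B η : ℝ}
    (hB : 1 ≤ B) (hη : 0 < η) (hη1 : η ≤ 1) :
    ∃ C : ℝ, 0 ≤ C ∧ ∀ (y : ℕ → X) (n : ℕ) (N : ℝ), 0 ≤ N → N ≤ dist (y 0) (y n) →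
      (∀ i ≤ n, (i : ℝ) ≤ B * dist (y 0) (y i) + B) →
      (∀ i < n, dist (y i) (y (i + 1)) ≤ 2 * B) →
      ∃ i ≤ n, N ≤ dist (y 0) (y i) ∧ dist (y 0) (y i) ≤ N + 2 * B ∧
        (1 - η) * N - C ≤ gromovProduct (y 0) (y i) (y n) := by
  have hB0 : 0 < B := by linarith
  obtain ⟨ε, hε, hδ⟩ : ∃ ε : ℝ, 0 < ε ∧ 2 * (ε * δ) ≤ Real.log 2 := by
    have hl := Real.log_pos one_lt_two
    refine ⟨Real.log 2 / (2 * (|δ| + 1)), by positivity, ?_⟩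
    have : 2 * (Real.log 2 / (2 * (|δ| + 1)) * δ) = Real.log 2 * (δ / (|δ| + 1)) := by
      field_simp
    rw [this]
    refine mul_le_of_le_one_right hl.le ?_
    rw [div_le_one (by positivity)]
    linarith [le_abs_self δ]
  set r : ℝ := Real.exp (-(ε * η / B)) with hr
  have hr1 : r < 1 := by
    rw [hr, Real.exp_lt_one_iff, neg_lt_zero]; positivity
  have hr0 : 0 < r := Real.exp_pos _
  have hr1' : 0 < 1 - r := by linarith
  set c : ℝ := Real.log (2 / (1 - r)) / ε with hc
  have hc0 : 0 ≤ c := by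
    refine div_nonneg (Real.log_nonneg ?_) hε.le
    rw [le_div_iff₀ hr1']; linarith
  refine ⟨η + 2 * B + c, by positivity, fun y n N hN hNn hlin hstep => ?_⟩
  classical
  -- from the index `i` on, the path stays at distance at least `N` from `y 0`
  have hex : ∃ i, ∀ j, i ≤ j → j ≤ n → N ≤ dist (y 0) (y j) :=
    ⟨n, fun j h1 h2 => by rwa [le_antisymm h2 h1]⟩
  set i := Nat.find hex with hi
  have hi1 : ∀ j, i ≤ j → j ≤ n → N ≤ dist (y 0) (y j) := Nat.find_spec hex
  have hin : i ≤ n := Nat.find_min' hex fun j h1 h2 => by rwa [le_antisymm h2 h1]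
  refine ⟨i, hin, hi1 i le_rfl hin, ?_, ?_⟩
  · rcases Nat.eq_zero_or_pos i with h0 | h0
    · rw [h0, dist_self]; positivity
    · have hlt : i - 1 < i := by omega
      have := Nat.find_min hex hlt
      push Not at this
      obtain ⟨j, h1, h2, h3⟩ := this
      have hj : j = i - 1 := by
        by_contra hj
        exact absurd (hi1 j (by omega) h2) (not_le.2 h3)
      have h4 := hstep (i - 1) (by omega)
      rw [show i - 1 + 1 = i by omega] at h4
      rw [hj] at h3
      linarith [dist_triangle (y 0) (y (i - 1)) (y i)]
  · by_cases hne : y i = y n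
    · have : gromovProduct (y 0) (y i) (y n) = dist (y 0) (y n) := by
        rw [hne]; simp [gromovProduct]
      rw [this]
      nlinarith
    have hsum := h.exp_gromovProduct_le_sum hε hδ (y 0) y hin hne
    set E : ℝ := (1 - η) * N - η - 2 * B with hE
    have hterm : ∀ j ∈ Finset.Ico i n,
        Real.exp (-(ε * gromovProduct (y 0) (y j) (y (j + 1)))) ≤
          Real.exp (-(ε * E)) * r ^ j := fun j hj => by
      rw [Finset.mem_Ico] at hj
      have h1 := hi1 j hj.1 hj.2.le
      have h2 := hlin j hj.2.le
      have h3 := hstep j hj.2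
      have h4 : (j : ℝ) / B - 1 ≤ dist (y 0) (y j) := by
        rw [sub_le_iff_le_add, div_le_iff₀ hB0]; linarith
      have h5 : dist (y 0) (y j) - 2 * B ≤ gromovProduct (y 0) (y j) (y (j + 1)) := by
        have := dist_triangle_right (y 0) (y j) (y (j + 1))
        simp only [gromovProduct]; linarith
      have h6 : E + η * (j / B) ≤ gromovProduct (y 0) (y j) (y (j + 1)) := by
        rw [hE]; nlinarith
      rw [hr, ← Real.exp_nat_mul, ← Real.exp_add, Real.exp_le_exp]
      have h7 := mul_le_mul_of_nonneg_left h6 hε.le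
      have h8 : (j : ℝ) * -(ε * η / B) = -(ε * (η * (j / B))) := by ring
      rw [h8]; linarith
    have hgeom : ∑ j ∈ Finset.Ico i n, r ^ j ≤ 1 / (1 - r) := by
      rw [one_div, ← tsum_geometric_of_lt_one hr0.le hr1]
      exact (summable_geometric_of_lt_one hr0.le hr1).sum_le_tsum _ fun _ _ => by positivity
    have hfin : Real.exp (-(ε * gromovProduct (y 0) (y i) (y n))) ≤
        Real.exp (-(ε * E)) * (2 / (1 - r)) := by
      refine hsum.trans ?_
      calc _ ≤ 2 * ∑ j ∈ Finset.Ico i n, Real.exp (-(ε * E)) * r ^ j :=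
            mul_le_mul_of_nonneg_left (Finset.sum_le_sum hterm) two_pos.le
        _ = Real.exp (-(ε * E)) * (2 * ∑ j ∈ Finset.Ico i n, r ^ j) := by
            rw [← Finset.mul_sum]; ring
        _ ≤ Real.exp (-(ε * E)) * (2 * (1 / (1 - r))) := by gcongr
        _ = _ := by ring
    have hexp : Real.exp (ε * c) = 2 / (1 - r) := by
      rw [hc, mul_div_cancel₀ _ hε.ne', Real.exp_log (by positivity)]
    rw [← hexp, ← Real.exp_add, Real.exp_le_exp] at hfin
    have : ε * (E - c) ≤ ε * gromovProduct (y 0) (y i) (y n) := by linarith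
    have := le_of_mul_le_mul_left this hε
    rw [hE] at this
    linarith

end GromovProduct

/-! ### Stability of quasi-geodesics -/

section QuasiIsometry

variable {X : Type u} [MetricSpace X] {Y : Type v} [MetricSpace Y]

/-- `f` is a quasi-isometric embedding; one constant bounds both multiplicative and additive
errors. -/
def IsQIEmbedding (B : ℝ) (f : X → Y) : Prop :=
  ∀ x y, dist (f x) (f y) ≤ B * dist x y + B ∧ dist x y ≤ B * dist (f x) (f y) + B

theorem IsQIEmbedding.mono {B B' : ℝ} {f : X → Y} (h : IsQIEmbedding B f) (hB : B ≤ B') :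
    IsQIEmbedding B' f := fun x y => by
  have h1 := h x y
  have h2 := mul_le_mul_of_nonneg_right hB (dist_nonneg (x := x) (y := y))
  have h3 := mul_le_mul_of_nonneg_right hB (dist_nonneg (x := f x) (y := f y))
  constructor <;> linarith

theorem isQIEmbedding_id : IsQIEmbedding 1 (id : X → X) := fun x y => by simp

theorem IsGeodesicSegment.exists_mem {x y : X} {s : Set X} (h : IsGeodesicSegment x y s) {u : ℝ}
    (h0 : 0 ≤ u) (h1 : u ≤ dist x y) : ∃ q ∈ s, dist x q = u ∧ dist q y = dist x y - u := by
  obtain ⟨γ, hx, hy, hγ, rfl⟩ := h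
  refine ⟨γ u, ⟨u, ⟨h0, h1⟩, rfl⟩, ?_, ?_⟩
  · have := hγ 0 ⟨le_rfl, dist_nonneg⟩ u ⟨h0, h1⟩
    rwa [hx, zero_sub, abs_neg, abs_of_nonneg h0] at this
  · have := hγ u ⟨h0, h1⟩ (dist x y) ⟨dist_nonneg, le_rfl⟩
    rwa [hy, abs_sub_comm, abs_of_nonneg (by linarith)] at this

theorem IsGeodesicSegment.dist_add_dist {x y q : X} {s : Set X} (h : IsGeodesicSegment x y s)
    (hq : q ∈ s) : dist x q + dist q y = dist x y := by
  obtain ⟨γ, hx, hy, hγ, rfl⟩ := h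
  obtain ⟨u, hu, rfl⟩ := hq
  have h1 := hγ 0 ⟨le_rfl, dist_nonneg⟩ u hu
  have h2 := hγ u hu (dist x y) ⟨dist_nonneg, le_rfl⟩
  rw [hx, zero_sub, abs_neg, abs_of_nonneg hu.1] at h1
  rw [hy, abs_sub_comm, abs_of_nonneg (by linarith [hu.2])] at h2
  linarith

theorem IsGeodesicSegment.dist_eq {x y q r : X} {s : Set X} (h : IsGeodesicSegment x y s)
    (hq : q ∈ s) (hr : r ∈ s) : dist q r = |dist x q - dist x r| := by
  obtain ⟨γ, hx, hy, hγ, rfl⟩ := h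
  obtain ⟨u, hu, rfl⟩ := hq
  obtain ⟨v, hv, rfl⟩ := hr
  have h1 := hγ 0 ⟨le_rfl, dist_nonneg⟩ u hu
  have h2 := hγ 0 ⟨le_rfl, dist_nonneg⟩ v hv
  rw [hx, zero_sub, abs_neg, abs_of_nonneg hu.1] at h1
  rw [hx, zero_sub, abs_neg, abs_of_nonneg hv.1] at h2
  rw [h1, h2]
  exact hγ u hu v hv

theorem IsGeodesicSegment.gromovProduct_eq_zero {x y q : X} {s : Set X}
    (h : IsGeodesicSegment x y s) (hq : q ∈ s) : gromovProduct q x y = 0 := by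
  have := h.dist_add_dist hq
  rw [dist_comm x q] at this
  simp only [gromovProduct]; linarith

/-- A quasi-isometric embedding maps some point `q` of a geodesic from `p` to `a` to a point whose
distance from the image of `p` is a given `N`, up to a constant, and which lies on the way to the
image of `a`, up to a small multiple of `N`. -/
theorem IsQIEmbedding.exists_gromovProduct_ge {δ B η : ℝ} (hY : FourPointWith Y δ)
    (hX : IsGeodesicSpace X) (hB : 1 ≤ B) (hη : 0 < η) (hη1 : η ≤ 1) :
    ∃ C : ℝ, 0 ≤ C ∧ ∀ (f : X → Y), IsQIEmbedding B f → ∀ (p a : X) (N : ℝ), 0 ≤ N →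
      N ≤ dist (f p) (f a) → ∃ q, dist p q + dist q a = dist p a ∧
        N ≤ dist (f p) (f q) ∧ dist (f p) (f q) ≤ N + C ∧
        (1 - η) * N - C ≤ gromovProduct (f p) (f q) (f a) := by
  obtain ⟨C, hC, key⟩ := hY.exists_gromovProduct_ge (B := B + 1) (by linarith) hη hη1
  refine ⟨C + 2 * (B + 1), by linarith, fun f hf p a N hN hNa => ?_⟩
  obtain ⟨s, hs⟩ := hX p a
  have hs' := hs
  obtain ⟨γ, hp, ha, hγ, rfl⟩ := hs
  set L := dist p a with hL
  have hL0 : 0 ≤ L := dist_nonneg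
  have hmem : ∀ i : ℕ, min (i : ℝ) L ∈ Set.Icc 0 L := fun i =>
    ⟨le_min (Nat.cast_nonneg i) hL0, min_le_right _ _⟩
  have hn : min (⌈L⌉₊ : ℝ) L = L := min_eq_right (Nat.le_ceil L)
  have h0 : γ (min ((0 : ℕ) : ℝ) L) = p := by rw [Nat.cast_zero, min_eq_left hL0, hp]
  have h1 : γ (min (⌈L⌉₊ : ℝ) L) = a := by rw [hn, ha]
  obtain ⟨i, hi, h2, h3, h4⟩ := key (fun i => f (γ (min (i : ℝ) L))) ⌈L⌉₊ N hN
    (by simpa only [h0, h1] using hNa)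
    (fun i hi => by
      have e1 := (hf (γ (min ((0 : ℕ) : ℝ) L)) (γ (min (i : ℝ) L))).2
      rw [hγ _ (hmem 0) _ (hmem i), abs_sub_comm, Nat.cast_zero, min_eq_left hL0, sub_zero,
        abs_of_nonneg (hmem i).1] at e1
      have e2 : (i : ℝ) - 1 ≤ min (i : ℝ) L := by
        refine le_min (by linarith) ?_
        have : (i : ℝ) ≤ ⌈L⌉₊ := by exact_mod_cast hi
        linarith [Nat.ceil_lt_add_one hL0]
      have e3 := dist_nonneg (x := f (γ 0)) (y := f (γ (min (i : ℝ) L)))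
      simp only [Nat.cast_zero, min_eq_left hL0]
      linarith)
    (fun i hi => by
      have e1 := (hf (γ (min (i : ℝ) L)) (γ (min ((i + 1 : ℕ) : ℝ) L))).1
      rw [hγ _ (hmem i) _ (hmem (i + 1))] at e1
      have e2 : |min (i : ℝ) L - min ((i + 1 : ℕ) : ℝ) L| ≤ 1 := by
        refine (abs_min_sub_min_le_max _ _ _ _).trans ?_
        simp
      nlinarith)
  simp only [h0, h1] at h2 h3 h4
  exact ⟨_, hs'.dist_add_dist ⟨_, hmem i, rfl⟩, h2, by linarith, by linarith⟩

/-- **Stability of quasi-geodesics** (Morse lemma): a quasi-isometric embedding of a geodesic space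
into a hyperbolic space maps a point lying almost between `a` and `b` to a point lying almost
between the images of `a` and `b`. -/
theorem IsQIEmbedding.gromovProduct_le {δ B : ℝ} (hY : FourPointWith Y δ)
    (hX : IsGeodesicSpace X) (hB : 1 ≤ B) (M : ℝ) :
    ∃ M' : ℝ, ∀ (f : X → Y), IsQIEmbedding B f → ∀ p a b : X, gromovProduct p a b ≤ M →
      gromovProduct (f p) (f a) (f b) ≤ M' := by
  have hB0 : 0 < B := by linarith
  -- for this value of `η`, the errors of size `η * N` are eventually absorbed
  set η : ℝ := 1 / (4 * B ^ 2) with hη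
  have hηB : η * B ^ 2 = 1 / 4 := by rw [hη]; field_simp
  have hη1 : η ≤ 1 := by
    rw [hη, div_le_one (by positivity)]; nlinarith
  have hη0 : 0 < η := by positivity
  obtain ⟨C, hC, key⟩ := IsQIEmbedding.exists_gromovProduct_ge hY hX hB hη0 hη1
  refine ⟨2 * (B * (B * (4 * C + 4 * δ) + B + 2 * M) + B), fun f hf p a b hM => ?_⟩
  set N := gromovProduct (f p) (f a) (f b) with hN
  have hN0 : 0 ≤ N := gromovProduct_nonneg _ _ _
  have hδ0 : 0 ≤ δ := by
    have := hY (f p) (f p) (f p) (f p)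
    simp only [dist_self, add_zero, max_self] at this
    linarith
  obtain ⟨q, q1, q2, q3, q4⟩ := key f hf p a N hN0 (gromovProduct_le_dist _ _ _)
  obtain ⟨r, r1, r2, r3, r4⟩ := key f hf p b N hN0
    (by rw [hN, gromovProduct_comm]; exact gromovProduct_le_dist _ _ _)
  rw [gromovProduct_comm] at r4
  have hprod : (1 - η) * N - C - 2 * δ ≤ gromovProduct (f p) (f q) (f r) := by
    have h1 := hY.min_le (f p) (f q) (f a) (f b)
    have h2 := hY.min_le (f p) (f q) (f b) (f r)
    have h3 : (1 - η) * N - C ≤ min (gromovProduct (f p) (f q) (f a))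
        (gromovProduct (f p) (f a) (f b)) := le_min q4 (by rw [← hN]; nlinarith)
    have h4 : (1 - η) * N - C - δ ≤ min (gromovProduct (f p) (f q) (f b))
        (gromovProduct (f p) (f b) (f r)) := le_min (by linarith) (by linarith)
    linarith
  have hfd : dist (f q) (f r) ≤ 2 * η * N + (4 * C + 4 * δ) := by
    have : dist (f q) (f r) = dist (f p) (f q) + dist (f p) (f r) -
      2 * gromovProduct (f p) (f q) (f r) := by simp only [gromovProduct]; ring
    linarith
  have hd : dist p q ≤ dist q r + 2 * M := by
    have h1 := dist_triangle4 a q r b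
    have h2 : dist p a + dist p b - dist a b ≤ 2 * M := by
      simp only [gromovProduct] at hM; linarith
    rw [dist_comm a q] at h1
    have := dist_nonneg (x := p) (y := r)
    linarith
  have h5 := (hf q r).2
  have h6 := (hf p q).1
  have h7 : dist q r ≤ B * (2 * η * N + (4 * C + 4 * δ)) + B := by nlinarith
  have h8 : N ≤ B * (B * (2 * η * N + (4 * C + 4 * δ)) + B + 2 * M) + B := by
    have : B * dist p q ≤ B * (B * (2 * η * N + (4 * C + 4 * δ)) + B + 2 * M) :=
      mul_le_mul_of_nonneg_left (by linarith) hB0.le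
    linarith
  have h9 : B * (B * (2 * η * N)) = N / 2 := by
    rw [show B * (B * (2 * η * N)) = 2 * (η * B ^ 2) * N by ring, hηB]; ring
  linarith

/-- Two points almost between `a` and `b`, at almost the same distance from `a`, are close. -/
theorem FourPointWith.dist_le_of_gromovProduct_le {δ M E : ℝ} (h : FourPointWith X δ)
    {a b p q : X} (hp : gromovProduct p a b ≤ M) (hq : gromovProduct q a b ≤ M)
    (hE : |dist a p - dist a q| ≤ E) : dist p q ≤ 2 * M + E + 2 * δ := by
  have h1 := h p q a b
  rw [abs_le] at hE
  simp only [gromovProduct] at hp hq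
  rw [dist_comm a p, dist_comm a q] at hE
  rcases max_choice (dist p a + dist q b) (dist p b + dist q a) with h' | h' <;>
  rw [h'] at h1 <;> linarith

/-- Converse of stability: a point whose image is almost between the images of `a` and `b` is close
to every geodesic from `a` to `b`. -/
theorem IsQIEmbedding.exists_mem_dist_le {δ B : ℝ} (hY : FourPointWith Y δ)
    (hX : IsGeodesicSpace X) (hB : 1 ≤ B) (M : ℝ) :
    ∃ E : ℝ, ∀ (f : X → Y), IsQIEmbedding B f → ∀ (p a b : X) (s : Set X),
      IsGeodesicSegment a b s → gromovProduct (f p) (f a) (f b) ≤ M →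
      ∃ q ∈ s, dist p q ≤ E := by
  obtain ⟨M', hM'⟩ := IsQIEmbedding.gromovProduct_le hY hX hB 0
  refine ⟨B * (2 * max M M' + 2 * B + 2 * M + 2 * δ) + B, fun f hf p a b s hs hM => ?_⟩
  have hB0 : 0 ≤ B := by linarith
  -- it suffices to find `q` such that `f q` is about as far from `f a` as `f p` is
  suffices hq : ∃ q ∈ s, |dist (f a) (f p) - dist (f a) (f q)| ≤ 2 * B + 2 * M by
    obtain ⟨q, hqs, hq⟩ := hq
    refine ⟨q, hqs, (hf p q).2.trans ?_⟩
    have h1 := hM' f hf q a b (hs.gromovProduct_eq_zero hqs).le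
    have := hY.dist_le_of_gromovProduct_le (hM.trans (le_max_left M M'))
      (h1.trans (le_max_right M M')) hq
    have := mul_le_mul_of_nonneg_left this hB0
    linarith
  have hM0 : 0 ≤ M := (gromovProduct_nonneg _ _ _).trans hM
  obtain ⟨γ, ha, hb, hγ, rfl⟩ := hs
  set L := dist a b with hL
  have hL0 : 0 ≤ L := dist_nonneg
  have hmem : ∀ i : ℕ, min (i : ℝ) L ∈ Set.Icc 0 L := fun i =>
    ⟨le_min (Nat.cast_nonneg i) hL0, min_le_right _ _⟩
  have hn : min (⌈L⌉₊ : ℝ) L = L := min_eq_right (Nat.le_ceil L)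
  rcases le_total (dist (f a) (f b)) (dist (f a) (f p)) with hle | hle
  · refine ⟨b, ⟨L, ⟨hL0, le_rfl⟩, hb⟩, ?_⟩
    rw [abs_of_nonneg (by linarith)]
    simp only [gromovProduct] at hM
    rw [dist_comm (f p) (f a)] at hM
    linarith [dist_nonneg (x := f p) (y := f b)]
  · classical
    have hex : ∃ i : ℕ, dist (f a) (f p) ≤ dist (f a) (f (γ (min (i : ℝ) L))) :=
      ⟨⌈L⌉₊, by rwa [hn, hb]⟩
    set i := Nat.find hex with hi
    have hi1 : dist (f a) (f p) ≤ dist (f a) (f (γ (min (i : ℝ) L))) := Nat.find_spec hex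
    refine ⟨_, ⟨_, hmem i, rfl⟩, ?_⟩
    rw [abs_sub_comm, abs_of_nonneg (by linarith)]
    rcases Nat.eq_zero_or_pos i with h0 | h0
    · rw [h0, Nat.cast_zero, min_eq_left hL0, ha, dist_self]
      linarith [dist_nonneg (x := f a) (y := f p)]
    · have h1 := Nat.find_min hex (m := i - 1) (by omega)
      have e1 := (hf (γ (min ((i - 1 : ℕ) : ℝ) L)) (γ (min (i : ℝ) L))).1
      rw [hγ _ (hmem _) _ (hmem _)] at e1
      have e2 : |min ((i - 1 : ℕ) : ℝ) L - min (i : ℝ) L| ≤ 1 := by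
        refine (abs_min_sub_min_le_max _ _ _ _).trans ?_
        rw [Nat.cast_sub h0]
        simp
      have e3 := mul_le_mul_of_nonneg_left e2 hB0
      have e4 := dist_triangle (f a) (f (γ (min ((i - 1 : ℕ) : ℝ) L))) (f (γ (min (i : ℝ) L)))
      linarith

/-- A geodesic space that embeds quasi-isometrically into a hyperbolic space is hyperbolic. -/
theorem IsQIEmbedding.fourPointHyperbolic {B : ℝ} {f : X → Y} (hf : IsQIEmbedding B f)
    (hX : IsGeodesicSpace X) (hY : FourPointHyperbolic fun a b : Y => dist a b) :
    FourPointHyperbolic fun a b : X => dist a b := by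
  obtain ⟨δ, hY⟩ := hY
  replace hY : FourPointWith Y δ := hY
  replace hf := hf.mono (le_max_left B 1)
  have hB := le_max_right B 1
  obtain ⟨M, hM⟩ := IsQIEmbedding.gromovProduct_le hY hX hB 0
  obtain ⟨E, hE⟩ := IsQIEmbedding.exists_mem_dist_le hY hX hB (M + δ)
  -- triangles are thin
  have near : ∀ p a b, gromovProduct (f p) (f a) (f b) ≤ M + δ →
      dist a p + dist p b ≤ dist a b + 2 * E := fun p a b h => by
    obtain ⟨s, hs⟩ := hX a b
    obtain ⟨q, hq, hpq⟩ := hE f hf p a b s hs h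
    have h1 := hs.dist_add_dist hq
    have h2 := dist_triangle_right a p q
    have h3 := dist_triangle p q b
    linarith
  have thin : ∀ (a b c p : X) (s : Set X), IsGeodesicSegment a b s → p ∈ s →
      dist a p + dist p c ≤ dist a c + 2 * E ∨ dist c p + dist p b ≤ dist c b + 2 * E :=
    fun a b c p s hs hp => by
      have h1 := hY.min_le (f p) (f a) (f c) (f b)
      have h2 := hM f hf p a b (hs.gromovProduct_eq_zero hp).le
      rcases min_choice (gromovProduct (f p) (f a) (f c)) (gromovProduct (f p) (f c) (f b)) with
        h | h <;> rw [h] at h1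
      · exact Or.inl (near p a c (by linarith))
      · exact Or.inr (near p c b (by linarith))
  -- by connectedness, some point of `[x, y]` is almost between `x`, `z` and between `z`, `y`
  have centre : ∀ (x y z : X) (s : Set X), IsGeodesicSegment x y s → ∃ p ∈ s,
      dist x p + dist p z ≤ dist x z + 2 * E ∧ dist z p + dist p y ≤ dist z y + 2 * E := by
    intro x y z s hs
    have hE0 : 0 ≤ E := by
      have h := hM f hf x x x (by simp [gromovProduct])
      have h0 := gromovProduct_nonneg (f x) (f x) (f x)
      have hδ := hY.min_le (f x) (f x) (f x) (f x)
      simp only [min_self] at hδ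
      have := near x x x (by linarith)
      simp only [dist_self] at this
      linarith
    have hs' := hs
    obtain ⟨γ, hx, hy, hγ, rfl⟩ := hs
    have hcont : ContinuousOn γ (Set.Icc 0 (dist x y)) := by
      refine LipschitzOnWith.continuousOn (K := 1) (LipschitzOnWith.of_dist_le_mul ?_)
      intro a ha b hb
      rw [hγ a ha b hb, NNReal.coe_one, one_mul, Real.dist_eq]
    have hpre : IsPreconnected (γ '' Set.Icc 0 (dist x y)) := isPreconnected_Icc.image γ hcont
    obtain ⟨p, hp, h1, h2⟩ := isPreconnected_closed_iff.1 hpre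
      {p | dist x p + dist p z ≤ dist x z + 2 * E} {p | dist z p + dist p y ≤ dist z y + 2 * E}
      (isClosed_le (by fun_prop) (by fun_prop)) (isClosed_le (by fun_prop) (by fun_prop))
      (fun p hp => thin x y z p _ hs' hp)
      ⟨x, ⟨0, ⟨le_rfl, dist_nonneg⟩, hx⟩, by simp [hE0]⟩
      ⟨y, ⟨_, ⟨dist_nonneg, le_rfl⟩, hy⟩, by simp [hE0]⟩
    exact ⟨p, hp, h1, h2⟩
  refine ⟨2 * E, fun x y z t => ?_⟩
  obtain ⟨s, hs⟩ := hX x y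
  obtain ⟨p, hp, h1, h2⟩ := centre x y z s hs
  have h3 := hs.dist_add_dist hp
  have h4 := dist_triangle z p t
  have e1 := dist_comm z p
  have e2 := dist_comm t p
  have e3 := dist_comm y z
  have e4 := dist_comm y t
  rcases thin x y t p s hs hp with h | h
  · have := le_max_right (dist x z + dist y t) (dist x t + dist y z)
    linarith
  · have := le_max_left (dist x z + dist y t) (dist x t + dist y z)
    linarith

end QuasiIsometry

/-! ### Orbit maps of proper cocompact actions -/

section Orbits

variable {G : Type u} [Group G] {X : Type v} [MetricSpace X] [MulAction G X]

/-- The word length of `g`, with respect to some finite subset of `G`, is bounded by an affine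
function of the displacement of the point `x₀` under `g`. -/
def DisplacementControlsLength (G : Type u) [Group G] {X : Type v} [MetricSpace X] [MulAction G X]
    (x₀ : X) : Prop :=
  ∃ T : Set G, T.Finite ∧ ∃ A : ℝ, 0 ≤ A ∧ ∀ g : G, ∃ l : List G,
    (∀ t ∈ l, t ∈ T) ∧ l.prod = g ∧ (l.length : ℝ) ≤ A * dist x₀ (g • x₀) + A

theorem finite_setOf_list_prod {T : Set G} (hT : T.Finite) (n : ℕ) :
    {g : G | ∃ l : List G, (∀ t ∈ l, t ∈ T) ∧ l.prod = g ∧ l.length ≤ n}.Finite := by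
  induction n with
  | zero =>
    refine (Set.finite_singleton (1 : G)).subset ?_
    rintro g ⟨l, -, rfl, hl⟩
    rw [List.length_eq_zero_iff.1 (Nat.le_zero.1 hl)]
    rfl
  | succ n ih =>
    refine ((Set.finite_singleton (1 : G)).union (hT.mul ih)).subset ?_
    rintro g ⟨l, hlT, rfl, hl⟩
    cases l with
    | nil => exact Or.inl rfl
    | cons t l =>
      refine Or.inr ?_
      rw [List.prod_cons]
      exact Set.mul_mem_mul (hlT t (by simp))
        ⟨l, fun s hs => hlT s (by simp [hs]), rfl, by simpa using hl⟩

/-- Metric properness of the action, at the point `x₀`. -/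
theorem DisplacementControlsLength.finite_setOf_dist_le {x₀ : X}
    (h : DisplacementControlsLength G x₀) (r : ℝ) : {g : G | dist x₀ (g • x₀) ≤ r}.Finite := by
  obtain ⟨T, hT, A, hA, hl⟩ := h
  refine (finite_setOf_list_prod hT ⌊A * r + A⌋₊).subset fun g hg => ?_
  obtain ⟨l, h1, h2, h3⟩ := hl g
  refine ⟨l, h1, h2, Nat.le_floor (h3.trans ?_)⟩
  have := mul_le_mul_of_nonneg_left (show dist x₀ (g • x₀) ≤ r from hg) hA
  linarith

theorem DisplacementControlsLength.countable {x₀ : X} (h : DisplacementControlsLength G x₀) :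
    Countable G := by
  rw [← Set.countable_univ_iff]
  have : (Set.univ : Set G) = ⋃ n : ℕ, {g : G | dist x₀ (g • x₀) ≤ n} := by
    refine (Set.eq_univ_of_forall fun g => ?_).symm
    exact Set.mem_iUnion.2 (exists_nat_ge (dist x₀ (g • x₀)))
  rw [this]
  exact Set.countable_iUnion fun n => (h.finite_setOf_dist_le n).countable

theorem dist_list_prod_smul_le [IsIsometricSMul G X] {T : Set G} {L : ℝ} {z : X}
    (hL : ∀ t ∈ T, dist z (t • z) ≤ L) (l : List G) (hl : ∀ t ∈ l, t ∈ T) :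
    dist z (l.prod • z) ≤ l.length * L := by
  induction l with
  | nil => simp
  | cons t l ih =>
    have h1 := hL t (hl t (by simp))
    have h2 := ih fun s hs => hl s (by simp [hs])
    have h3 := dist_triangle z (t • z) (t • l.prod • z)
    rw [dist_smul] at h3
    rw [List.prod_cons, mul_smul, List.length_cons, Nat.cast_add, Nat.cast_one]
    linarith

/-- Orbit distances of a controlled action dominate those of every other isometric action. -/
theorem DisplacementControlsLength.dist_smul_le [IsIsometricSMul G X] {x₀ : X}
    (h : DisplacementControlsLength G x₀) {Z : Type w} [MetricSpace Z] [MulAction G Z]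
    [IsIsometricSMul G Z] (z₀ : Z) :
    ∃ B : ℝ, 0 ≤ B ∧ ∀ a b : G, dist (a • z₀) (b • z₀) ≤ B * dist (a • x₀) (b • x₀) + B := by
  obtain ⟨T, hT, A, hA, hl⟩ := h
  obtain ⟨L, hL⟩ : ∃ L : ℝ, ∀ t ∈ T, dist z₀ (t • z₀) ≤ L := by
    obtain ⟨L, hL⟩ := (hT.image fun t => dist z₀ (t • z₀)).bddAbove
    exact ⟨L, fun t ht => hL ⟨t, ht, rfl⟩⟩
  refine ⟨A * max L 0, by positivity, fun a b => ?_⟩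
  obtain ⟨l, h1, h2, h3⟩ := hl (a⁻¹ * b)
  have h4 := dist_list_prod_smul_le (fun t ht => (hL t ht).trans (le_max_left L 0)) l h1
  rw [h2] at h4
  have e1 : dist (a • z₀) (b • z₀) = dist z₀ ((a⁻¹ * b) • z₀) := by
    rw [← dist_smul a z₀, smul_smul, mul_inv_cancel_left]
  have e2 : dist (a • x₀) (b • x₀) = dist x₀ ((a⁻¹ * b) • x₀) := by
    rw [← dist_smul a x₀, smul_smul, mul_inv_cancel_left]
  rw [e1, e2]
  have := mul_le_mul_of_nonneg_right h3 (le_max_right L 0)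
  linarith

/-- Spaces with controlled coarsely dense orbits are quasi-isometric, by a map that almost extends
the map `g • x₀ ↦ g • z₀` of the orbits. -/
theorem DisplacementControlsLength.exists_isQIEmbedding [IsIsometricSMul G X] {x₀ : X}
    (hx : DisplacementControlsLength G x₀) {Z : Type w} [MetricSpace Z] [MulAction G Z]
    [IsIsometricSMul G Z] {z₀ : Z} (hz : DisplacementControlsLength G z₀) {D : ℝ}
    (hD : ∀ x : X, ∃ g : G, dist x (g • x₀) ≤ D) :
    ∃ B : ℝ, 1 ≤ B ∧ ∃ f : X → Z, IsQIEmbedding B f ∧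
      ∀ (x : X) (g : G), dist (f x) (g • z₀) ≤ B * dist x (g • x₀) + B := by
  obtain ⟨A, hA, h1⟩ := hx.dist_smul_le z₀
  obtain ⟨A', hA', h2⟩ := hz.dist_smul_le x₀
  choose q hq using fun x => (hD x).imp fun g hg => hg.trans (le_abs_self D)
  have n0 := abs_nonneg D
  set c := |D| with hc
  have n1 := mul_nonneg hA n0
  refine ⟨A * (2 * c + 1) + A' + 2 * c + 1, by linarith, fun x => q x • z₀, fun x y => ?_,
    fun x g => ?_⟩
  · have e1 := h1 (q x) (q y)
    have e2 := h2 (q x) (q y)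
    have e3 := dist_triangle4 (q x • x₀) x y (q y • x₀)
    have e4 := dist_triangle4 x (q x • x₀) (q y • x₀) y
    rw [dist_comm (q x • x₀) x] at e3
    rw [dist_comm (q y • x₀) y] at e4
    have e5 := hq x
    have e6 := hq y
    have e7 := mul_le_mul_of_nonneg_left
      (show dist (q x • x₀) (q y • x₀) ≤ dist x y + 2 * c by linarith) hA
    have n2 := mul_nonneg (show 0 ≤ 2 * (A * c) + A' + 2 * c + 1 by linarith)
      (dist_nonneg (x := x) (y := y))
    have n3 := mul_nonneg (show 0 ≤ 2 * (A * c) + A + 2 * c + 1 by linarith)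
      (dist_nonneg (x := q x • z₀) (y := q y • z₀))
    constructor <;> linarith
  · have e1 := h1 (q x) g
    have e2 := dist_triangle (q x • x₀) x (g • x₀)
    rw [dist_comm (q x • x₀) x] at e2
    have e3 := mul_le_mul_of_nonneg_left
      (show dist (q x • x₀) (g • x₀) ≤ dist x (g • x₀) + c by linarith [hq x]) hA
    have n2 := mul_nonneg (show 0 ≤ 2 * (A * c) + A' + 2 * c + 1 by linarith)
      (dist_nonneg (x := x) (y := g • x₀))
    linarith

/-- A compact set has a neighbourhood of uniform size that meets only finitely many translates. -/
theorem exists_finite_setOf_dist_lt (hprop : ProperlyDiscontinuousSMul G X) {K : Set X}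
    (hK : IsCompact K) :
    ∃ ε : ℝ, 0 < ε ∧ {g : G | ∃ k ∈ K, ∃ k' ∈ K, dist (g • k) k' < ε}.Finite := by
  classical
  by_contra! hcon
  obtain ⟨f, hf, hlt⟩ := exists_seq_of_forall_finset_exists
    (fun q : ℕ × G => ∃ k ∈ K, ∃ k' ∈ K, dist (q.2 • k) k' < 1 / ((q.1 : ℝ) + 1))
    (fun q q' => q.1 < q'.1 ∧ q.2 ≠ q'.2) (fun s _ => by
      set n := s.sup Prod.fst + 1
      obtain ⟨g, hg, hgs⟩ := (hcon (1 / ((n : ℝ) + 1)) (by positivity)).exists_notMem_finset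
        (s.image Prod.snd)
      refine ⟨(n, g), hg, fun q hq => ⟨Nat.lt_succ_of_le (Finset.le_sup (f := Prod.fst) hq), ?_⟩⟩
      rintro rfl
      exact hgs (Finset.mem_image_of_mem _ hq))
  choose k hk k' hk' hkk using hf
  have hmono : StrictMono fun n => (f n).1 := fun m n hmn => (hlt m n hmn).1
  have hinj : Function.Injective fun n => (f n).2 := fun m n hmn => by
    by_contra hne
    rcases lt_or_gt_of_ne hne with h | h
    · exact (hlt m n h).2 hmn
    · exact (hlt n m h).2 hmn.symm
  obtain ⟨a, -, φ, hφ, hlim⟩ := hK.tendsto_subseq hk'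
  have hlim' : Filter.Tendsto (fun n => (f (φ n)).2 • k (φ n)) Filter.atTop (nhds a) := by
    refine (tendsto_iff_of_dist ?_).2 hlim
    refine squeeze_zero (fun _ => dist_nonneg) (fun n => (hkk (φ n)).le.trans ?_)
      tendsto_one_div_add_atTop_nhds_zero_nat
    have : n ≤ (f (φ n)).1 := (hmono.comp hφ).id_le n
    gcongr
  have hfin := hprop.finite_disjoint_inter_image hK hlim'.isCompact_insert_range
  refine Set.infinite_range_of_injective (hinj.comp hφ.injective) (hfin.subset ?_)
  rintro _ ⟨n, rfl⟩
  exact ⟨(f (φ n)).2 • k (φ n), ⟨_, hk _, rfl⟩, Or.inr ⟨n, rfl⟩⟩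

/-- **Milnor–Schwarz**: a proper cocompact isometric action on a geodesic space has coarsely dense
orbits, and displacements control word lengths. -/
theorem exists_displacementControlsLength [IsIsometricSMul G X] [Nonempty X]
    (hX : IsGeodesicSpace X) (hprop : ProperlyDiscontinuousSMul G X)
    (hcoc : IsCocompactAction G X) :
    ∃ (x₀ : X) (D : ℝ), (∀ x : X, ∃ g : G, dist x (g • x₀) ≤ D) ∧
      DisplacementControlsLength G x₀ := by
  obtain ⟨K, hK, hcov⟩ := hcoc
  have hcov' : ∀ x : X, ∃ g : G, ∃ k ∈ K, g • k = x := fun x => by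
    have : x ∈ ⋃ g : G, g • K := hcov ▸ Set.mem_univ x
    obtain ⟨g, hg⟩ := Set.mem_iUnion.1 this
    exact ⟨g, hg⟩
  obtain ⟨-, x₀, hx₀, -⟩ := hcov' (Classical.arbitrary X)
  refine ⟨x₀, Metric.diam K, fun x => ?_, ?_⟩
  · obtain ⟨g, k, hk, rfl⟩ := hcov' x
    exact ⟨g, by rw [dist_smul]; exact Metric.dist_le_diam_of_mem hK.isBounded hk hx₀⟩
  obtain ⟨ε, hε, hfin⟩ := exists_finite_setOf_dist_lt hprop hK
  refine ⟨_, hfin, 2 / ε + 2, by positivity, fun g => ?_⟩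
  obtain ⟨-, γ, h0, h1, hγ, -⟩ := hX x₀ (g • x₀)
  set L := dist x₀ (g • x₀) with hL
  have hL0 : 0 ≤ L := dist_nonneg
  set u : ℕ → ℝ := fun i => min (i * (ε / 2)) L with hu
  have hmem : ∀ i, u i ∈ Set.Icc 0 L := fun i => ⟨le_min (by positivity) hL0, min_le_right _ _⟩
  -- follow the geodesic in steps of length `ε / 2`
  have key : ∀ (i : ℕ) (h : G), (∃ k ∈ K, h • k = γ (u i)) → ∃ l : List G,
      (∀ t ∈ l, t ∈ {g : G | ∃ k ∈ K, ∃ k' ∈ K, dist (g • k) k' < ε}) ∧ l.prod = h ∧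
        l.length = i + 1 := by
    intro i
    induction i with
    | zero =>
      rintro h ⟨k, hk, hhk⟩
      refine ⟨[h], ?_, by simp, rfl⟩
      simp only [List.mem_singleton, forall_eq]
      refine ⟨k, hk, x₀, hx₀, ?_⟩
      have : u 0 = 0 := by simp [hu, hL0]
      rwa [hhk, this, h0, dist_self]
    | succ i ih =>
      rintro h ⟨k, hk, hhk⟩
      obtain ⟨h', k', hk', hhk'⟩ := hcov' (γ (u i))
      obtain ⟨l, hl, hprod, hlen⟩ := ih h' ⟨k', hk', hhk'⟩
      refine ⟨l ++ [h'⁻¹ * h], ?_, by simp [hprod], by simp [hlen]⟩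
      intro t ht
      rcases List.mem_append.1 ht with ht | ht
      · exact hl t ht
      · rw [List.mem_singleton] at ht
        subst ht
        refine ⟨k, hk, k', hk', ?_⟩
        rw [← dist_smul h', smul_smul, mul_inv_cancel_left, hhk, hhk', hγ _ (hmem _) _ (hmem _)]
        refine (abs_min_sub_min_le_max _ _ _ _).trans_lt ?_
        rw [sub_self, abs_zero, ← sub_mul, abs_mul, abs_of_pos (half_pos hε)]
        simp [hε]
  set n := ⌈L / (ε / 2)⌉₊ with hn
  have hun : u n = L := min_eq_right <| by
    rw [← div_le_iff₀ (half_pos hε)]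
    exact Nat.le_ceil _
  obtain ⟨l, hl, hprod, hlen⟩ := key n g ⟨x₀, hx₀, by rw [hun, h1]⟩
  refine ⟨l, hl, hprod, ?_⟩
  have h2 : (n : ℝ) < L / (ε / 2) + 1 := Nat.ceil_lt_add_one (by positivity)
  have h3 : L / (ε / 2) = 2 / ε * L := by field_simp
  have h4 : 0 ≤ 2 / ε := by positivity
  rw [hlen, Nat.cast_add, Nat.cast_one]
  linarith

/-- A hyperbolic group acts on geodesic spaces, properly and cocompactly, only if they are
hyperbolic. -/
theorem IsHyperbolicGroup.fourPointHyperbolic [IsIsometricSMul G X] (hG : IsHyperbolicGroup G)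
    (hX : IsGeodesicSpace X) {x₀ : X} {D : ℝ} (hD : ∀ x : X, ∃ g : G, dist x (g • x₀) ≤ D)
    (hlen : DisplacementControlsLength G x₀) : FourPointHyperbolic fun x y : X => dist x y := by
  obtain ⟨S, hS, hhyp⟩ := hG
  set Γ := SimpleGraph.mulCayley (S : Set G) with hΓ
  have hadj : ∀ a b, Γ.Adj a b ↔ a ≠ b ∧ ∃ s ∈ (S : Set G), a * s = b ∨ a = b * s :=
    SimpleGraph.mulCayley_adj' _
  have htrans : ∀ c a b : G, Γ.Reachable a b → Γ.Reachable (c * a) (c * b) := fun c a b h =>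
    h.map (⟨fun x => c * x, fun h => SimpleGraph.mulCayley_adj_mul_iff_right.2 h⟩ : Γ →g Γ)
  have hreach : ∀ g : G, Γ.Reachable 1 g := fun g => by
    have hg : g ∈ Subgroup.closure (S : Set G) := hS ▸ Subgroup.mem_top g
    induction hg using Subgroup.closure_induction with
    | mem s hs =>
      by_cases h : (1 : G) = s
      · rw [← h]
      · exact ((hadj 1 s).2 ⟨h, s, hs, Or.inl (one_mul s)⟩).reachable
    | one => rfl
    | mul a b _ _ ha hb => exact ha.trans (by simpa using htrans a 1 b hb)
    | inv a _ ha => simpa using (htrans a⁻¹ 1 a ha).symm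
  have hconn : Γ.Connected :=
    { preconnected := fun a b => (hreach a).symm.trans (hreach b)
      nonempty := ⟨1⟩ }
  let _ : MetricSpace G :=
    { dist := fun a b => (Γ.dist a b : ℝ)
      dist_self := fun a => by simp
      dist_comm := fun a b => by rw [SimpleGraph.dist_comm]
      dist_triangle := fun a b c => by exact_mod_cast hconn.dist_triangle
      eq_of_dist_eq_zero := fun {a b} h => by
        have : Γ.dist a b = 0 := by exact_mod_cast h
        exact hconn.dist_eq_zero_iff.1 this }
  have hle : ∀ c a b : G, Γ.dist (c * a) (c * b) ≤ Γ.dist a b := fun c a b => by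
    obtain ⟨w, hw⟩ := hconn.exists_walk_length_eq_dist a b
    let f : Γ →g Γ := ⟨fun x => c * x, fun h => SimpleGraph.mulCayley_adj_mul_iff_right.2 h⟩
    rw [← hw, ← SimpleGraph.Walk.length_map f w]
    exact SimpleGraph.dist_le _
  have : IsIsometricSMul G G := ⟨fun c => Isometry.of_dist_eq fun a b => by
    change (Γ.dist (c * a) (c * b) : ℝ) = Γ.dist a b
    have := hle c⁻¹ (c * a) (c * b)
    rw [inv_mul_cancel_left, inv_mul_cancel_left] at this
    exact_mod_cast le_antisymm (hle c a b) this⟩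
  have hwalk : ∀ {a b : G} (w : Γ.Walk a b), ∃ l : List G,
      (∀ t ∈ l, t ∈ (S : Set G) ∪ (S : Set G)⁻¹) ∧ a * l.prod = b ∧ l.length = w.length := by
    intro a b w
    induction w with
    | nil => exact ⟨[], by simp⟩
    | @cons a b c h w ih =>
      obtain ⟨l, h1, h2, h3⟩ := ih
      obtain ⟨-, s, hs, h4⟩ := (hadj a b).1 h
      refine ⟨(a⁻¹ * b) :: l, ?_, by simp [mul_assoc, h2], by simp [h3]⟩
      intro t ht
      rcases List.mem_cons.1 ht with rfl | ht
      · rcases h4 with rfl | rfl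
        · left; simpa using hs
        · right; simpa using hs
      · exact h1 t ht
  have hlenG : DisplacementControlsLength G (1 : G) := by
    refine ⟨_, S.finite_toSet.union S.finite_toSet.inv, 1, zero_le_one, fun g => ?_⟩
    obtain ⟨w, hw⟩ := hconn.exists_walk_length_eq_dist 1 g
    obtain ⟨l, h1, h2, h3⟩ := hwalk w
    refine ⟨l, h1, by simpa using h2, ?_⟩
    have : dist (1 : G) (g • (1 : G)) = Γ.dist 1 g := by rw [smul_eq_mul, mul_one]; rfl
    rw [this, h3, hw]
    linarith
  obtain ⟨B, -, f, hf, -⟩ := hlen.exists_isQIEmbedding hlenG hD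
  exact hf.fourPointHyperbolic hX hhyp

end Orbits

/-! ### Transfer of cylinders between spaces -/

section Transfer

variable {X : Type v} [MetricSpace X]

theorem IsCylinder.gromovProduct_le {θ : ℝ} {x y p : X} {C : Set X} (hX : IsGeodesicSpace X)
    (h : IsCylinder θ x y C) (hp : p ∈ C) : gromovProduct p x y ≤ |θ| + 1 := by
  obtain ⟨s, hs⟩ := hX x y
  have h1 := Metric.cthickening_subset_thickening' (δ₂ := |θ| + 1) (by positivity)
    (by linarith [le_abs_self θ]) s ((h s hs).2 hp)
  obtain ⟨q, hq, hpq⟩ := Metric.mem_thickening_iff.1 h1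
  have := gromovProduct_le_add p x y q x y
  rw [hs.gromovProduct_eq_zero hq, dist_self, dist_self] at this
  linarith

/-- The points of a cylinder of `x, y` that are almost between `x` and `z` lie in the ball around
`x` whose radius is the Gromov product, except for points close to some `w`. -/
theorem IsCylinder.exists_centre {θ : ℝ} {x y : X} {C : Set X} (hX : IsGeodesicSpace X)
    (h : IsCylinder θ x y C) (z : X) (M : ℝ) : ∃ w, ∀ p ∈ C, gromovProduct p x z ≤ M →
      dist p x ≤ gromovProduct x y z ∨ dist p w ≤ 3 * (|θ| + 1) + M := by
  obtain ⟨s, hs⟩ := hX x y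
  obtain ⟨w, hw, hxw, -⟩ := hs.exists_mem (gromovProduct_nonneg x y z) (gromovProduct_le_dist x y z)
  refine ⟨w, fun p hp hM => ?_⟩
  by_contra! hcon
  have h1 := Metric.cthickening_subset_thickening' (δ₂ := |θ| + 1) (by positivity)
    (by linarith [le_abs_self θ]) s ((h s hs).2 hp)
  obtain ⟨q, hq, hpq⟩ := Metric.mem_thickening_iff.1 h1
  have h2 := hs.dist_eq hq hw
  have h3 := dist_triangle p q w
  have h4 := hs.dist_add_dist hq
  have h5 := dist_triangle x q p
  have h6 := dist_triangle x p q
  have h7 := dist_triangle p q y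
  have hM0 := (gromovProduct_nonneg p x z).trans hM
  rw [dist_comm q p] at h5
  rw [dist_comm p x] at hcon
  simp only [gromovProduct] at hM hcon hxw
  rw [dist_comm p x] at hM
  have h8 := dist_triangle y p z
  rw [dist_comm y p] at h8
  have h9 : |dist x q - dist x w| ≤ 2 * (|θ| + 1) + M := by
    rw [hxw, abs_le]
    constructor <;> linarith [abs_nonneg θ]
  linarith

/-- In a globally stable choice of cylinders, `C x y` and `C x z` also coincide, up to finitely
many balls, on the set of points almost between `x` and `y` and almost between `x` and `z`. -/
theorem IsGloballyStable.exists_forall_mem {θ : ℝ} {C : X → X → Set X} (hX : IsGeodesicSpace X)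
    (h : IsGloballyStable θ C) (M : ℝ) : ∃ (k : ℕ) (R : ℝ), ∀ x y z, ∃ c : Fin k → X, ∀ p,
      (∀ i, R < dist p (c i)) →
      (p ∈ C x y → gromovProduct p x z ≤ M → p ∈ C x z) ∧
      (p ∈ C x z → gromovProduct p x y ≤ M → p ∈ C x y) := by
  obtain ⟨hcyl, -, k, R, -, hstab⟩ := h
  refine ⟨k + 2, max R (3 * (|θ| + 1) + M), fun x y z => ?_⟩
  obtain ⟨c, hc⟩ := hstab x y z
  obtain ⟨w, hw⟩ := (hcyl x y).exists_centre hX z M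
  obtain ⟨w', hw'⟩ := (hcyl x z).exists_centre hX y M
  rw [gromovProduct_comm x z y] at hw'
  refine ⟨Fin.cons w (Fin.cons w' c), fun p hp => ?_⟩
  have hpw : 3 * (|θ| + 1) + M < dist p w := (le_max_right _ _).trans_lt (hp 0)
  have hpw' : 3 * (|θ| + 1) + M < dist p w' :=
    (le_max_right _ _).trans_lt (hp (Fin.succ 0))
  have hpc : p ∉ ⋃ i, Metric.closedBall (c i) R := by
    simp only [Set.mem_iUnion, Metric.mem_closedBall, not_exists, not_le]
    exact fun i => (le_max_left _ _).trans_lt (hp i.succ.succ)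
  refine ⟨fun h1 h2 => ?_, fun h1 h2 => ?_⟩
  · have h3 := (hw p h1 h2).resolve_right (not_le.2 hpw)
    exact (hc.subset ⟨⟨h1, h3⟩, hpc⟩).1.1
  · have h3 := (hw' p h1 h2).resolve_right (not_le.2 hpw')
    exact (hc.symm.subset ⟨⟨h1, h3⟩, hpc⟩).1.1

/-- In a hyperbolic space, a point almost between `x` and `y` whose distance from `x` is at most the
Gromov product of `y` and `z` is also almost between `x` and `z`. -/
theorem FourPointWith.gromovProduct_le {δ M : ℝ} (h : FourPointWith X δ) {p x y z : X}
    (hM : gromovProduct p x y ≤ M) (hp : dist p x ≤ gromovProduct x y z) :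
    gromovProduct p x z ≤ M + δ := by
  have h1 := h.min_le x p y z
  have e : ∀ t, gromovProduct x p t = dist p x - gromovProduct p x t := fun t => by
    simp only [gromovProduct, dist_comm x p]; ring
  have h2 : dist p x - M ≤ min (gromovProduct x p y) (gromovProduct x y z) := by
    refine le_min ?_ ?_
    · rw [e]; linarith
    · have := (gromovProduct_nonneg p x y).trans hM
      linarith
  rw [e z] at h1
  linarith

variable {G : Type u} [Group G] [MulAction G X] {X' : Type w} [MetricSpace X'] [MulAction G X']

/-- Almost being between two points is, for points of orbits, independent of the space. -/
theorem exists_gromovProduct_smul_le [IsIsometricSMul G X] [IsIsometricSMul G X']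
    (hX : IsGeodesicSpace X) {δ' : ℝ} (hX' : FourPointWith X' δ') {B : ℝ} (hB : 1 ≤ B)
    {x₀ : X} {x₀' : X'} {f : X → X'} (hf : IsQIEmbedding B f)
    (hfx : ∀ (x : X) (g : G), dist (f x) (g • x₀') ≤ B * dist x (g • x₀) + B) (M : ℝ) :
    ∃ M' : ℝ, ∀ a g h : G, gromovProduct (a • x₀) (g • x₀) (h • x₀) ≤ M →
      gromovProduct (a • x₀') (g • x₀') (h • x₀') ≤ M' := by
  obtain ⟨M', hM'⟩ := IsQIEmbedding.gromovProduct_le hX' hX hB M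
  refine ⟨M' + 3 * B, fun a g h hM => ?_⟩
  have h1 := hM' f hf _ _ _ hM
  have h2 : ∀ g : G, dist (g • x₀') (f (g • x₀)) ≤ B := fun g => by
    have := hfx (g • x₀) g
    rwa [dist_self, mul_zero, zero_add, dist_comm] at this
  have h3 := gromovProduct_le_add (a • x₀') (g • x₀') (h • x₀') (f (a • x₀)) (f (g • x₀))
    (f (h • x₀))
  linarith [h2 a, h2 g, h2 h]

/-- The image in `X'` of a choice `C` of cylinders in `X`, under the relation that `x' : X'`
corresponds to `g • x₀` for every `g` such that `x'` is `D`-close to `g • x₀'`. Using all such `g`,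
rather than one choice for each `x'`, makes the result equivariant in the presence of
stabilizers. -/
def transferredCylinder (G : Type u) [Group G] [MulAction G X] [MulAction G X'] (x₀ : X)
    (x₀' : X') (D E : ℝ) (C : X → X → Set X) (x' y' : X') : Set X' :=
  {p' | ∃ a g h : G, dist p' (a • x₀') ≤ D ∧ dist x' (g • x₀') ≤ D ∧ dist y' (h • x₀') ≤ D ∧
    ∃ p ∈ C (g • x₀) (h • x₀), dist p (a • x₀) ≤ E}

theorem transferredCylinder_comm {C : X → X → Set X} (hC : ∀ x y, C x y = C y x) (x₀ : X)
    (x₀' : X') (D E : ℝ) (x' y' : X') :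
    transferredCylinder G x₀ x₀' D E C x' y' = transferredCylinder G x₀ x₀' D E C y' x' := by
  ext p'
  constructor <;>
  · rintro ⟨a, g, h, h1, h2, h3, p, hp, h4⟩
    exact ⟨a, h, g, h1, h3, h2, p, hC _ _ ▸ hp, h4⟩

theorem transferredCylinder_smul [IsIsometricSMul G X] [IsIsometricSMul G X'] {C : X → X → Set X}
    (hC : ∀ (g : G) (x y : X), C (g • x) (g • y) = g • C x y) (x₀ : X)
    (x₀' : X') (D E : ℝ) (g : G) (x' y' : X') :
    transferredCylinder G x₀ x₀' D E C (g • x') (g • y') =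
      g • transferredCylinder G x₀ x₀' D E C x' y' := by
  have key : ∀ (b : G) (x' y' p' : X'), p' ∈ transferredCylinder G x₀ x₀' D E C x' y' →
      b • p' ∈ transferredCylinder G x₀ x₀' D E C (b • x') (b • y') := by
    rintro b x' y' p' ⟨a, g, h, h1, h2, h3, p, hp, h4⟩
    refine ⟨b * a, b * g, b * h, ?_, ?_, ?_, b • p, ?_, ?_⟩
    · rwa [mul_smul, dist_smul]
    · rwa [mul_smul, dist_smul]
    · rwa [mul_smul, dist_smul]
    · rw [mul_smul, mul_smul, hC]
      exact Set.smul_mem_smul_set hp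
    · rwa [mul_smul, dist_smul]
  ext p'
  rw [Set.mem_smul_set_iff_inv_smul_mem]
  constructor
  · intro hp
    simpa using key g⁻¹ _ _ _ hp
  · intro hp
    simpa using key g _ _ _ hp

/-- Invariant globally stable cylinders pass from one hyperbolic geodesic space with a proper
cocompact action to another. -/
theorem AdmitsInvariantStableCylinders.transfer [IsIsometricSMul G X] [IsIsometricSMul G X']
    (hX : IsGeodesicSpace X) (hX' : IsGeodesicSpace X')
    (hyp : FourPointHyperbolic fun x y : X => dist x y)
    (hyp' : FourPointHyperbolic fun x y : X' => dist x y)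
    {x₀ : X} {x₀' : X'} {D₀ D : ℝ} (hD₀ : ∀ x : X, ∃ g : G, dist x (g • x₀) ≤ D₀)
    (hD : ∀ x : X', ∃ g : G, dist x (g • x₀') ≤ D)
    (hlen : DisplacementControlsLength G x₀) (hlen' : DisplacementControlsLength G x₀')
    (hadm : AdmitsInvariantStableCylinders G X) : AdmitsInvariantStableCylinders G X' := by
  obtain ⟨θ, hθ, C, hC, hinv⟩ := hadm
  obtain ⟨δ, hδ⟩ := hyp
  obtain ⟨δ', hδ'⟩ := hyp'
  replace hδ : FourPointWith X δ := hδ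
  replace hδ' : FourPointWith X' δ' := hδ'
  obtain ⟨B, hB, f, hf, hfx⟩ := hlen.exists_isQIEmbedding hlen' hD₀
  obtain ⟨B', hB', f', hf', hfx'⟩ := hlen'.exists_isQIEmbedding hlen hD
  obtain ⟨M₁, hM₁⟩ := exists_gromovProduct_smul_le (G := G) hX' hδ hB' hf' hfx' (3 * D)
  obtain ⟨E, hE⟩ := IsQIEmbedding.exists_mem_dist_le hδ hX le_rfl M₁
  obtain ⟨M₂, hM₂⟩ := exists_gromovProduct_smul_le (G := G) hX hδ' hB hf hfx (|θ| + 1 + E)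
  obtain ⟨θ', hθ'⟩ := IsQIEmbedding.exists_mem_dist_le hδ' hX' le_rfl (M₂ + 3 * D)
  obtain ⟨M₃, hM₃⟩ := exists_gromovProduct_smul_le (G := G) hX' hδ hB' hf' hfx'
    (M₂ + 3 * D + δ' + 3 * D)
  obtain ⟨k, R, hstab⟩ := hC.exists_forall_mem hX (M₃ + E)
  set C' := transferredCylinder G x₀ x₀' D E C with hC'
  -- points of `C' x' y'` are almost between `x'` and `y'`
  have hbetween : ∀ x' y' p', p' ∈ C' x' y' → gromovProduct p' x' y' ≤ M₂ + 3 * D := by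
    rintro x' y' p' ⟨a, g, h, h1, h2, h3, p, hp, h4⟩
    have h5 := (hC.1 _ _).gromovProduct_le hX hp
    have h6 := gromovProduct_le_add (a • x₀) (g • x₀) (h • x₀) p (g • x₀) (h • x₀)
    rw [dist_comm (a • x₀) p, dist_self, dist_self] at h6
    have h7 := hM₂ a g h (by linarith)
    have h8 := gromovProduct_le_add p' x' y' (a • x₀') (g • x₀') (h • x₀')
    linarith
  refine ⟨max θ' 0, le_max_right _ _, C', ⟨fun x' y' s hs => ⟨fun p' hp' => ?_, fun p' hp' => ?_⟩,
    transferredCylinder_comm hC.2.1 x₀ x₀' D E, ?_⟩, transferredCylinder_smul hinv x₀ x₀' D E⟩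
  · obtain ⟨a, ha⟩ := hD p'
    obtain ⟨g, hg⟩ := hD x'
    obtain ⟨h, hh⟩ := hD y'
    have h1 := gromovProduct_le_add (a • x₀') (g • x₀') (h • x₀') p' x' y'
    rw [hs.gromovProduct_eq_zero hp', dist_comm _ p', dist_comm _ x', dist_comm _ y'] at h1
    obtain ⟨t, ht⟩ := hX (g • x₀) (h • x₀)
    obtain ⟨q, hq, hqE⟩ := hE id isQIEmbedding_id (a • x₀) _ _ t ht (hM₁ a g h (by linarith))
    exact ⟨a, g, h, ha, hg, hh, q, (hC.1 _ _ t ht).1 hq, by rwa [dist_comm]⟩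
  · obtain ⟨q, hq, hpq⟩ := hθ' id isQIEmbedding_id p' x' y' s hs (hbetween x' y' p' hp')
    exact Metric.mem_cthickening_of_dist_le p' q _ s hq (hpq.trans (le_max_left _ _))
  · have hfin : {t : G | dist x₀' (t • x₀') ≤ 2 * D}.Finite := hlen'.finite_setOf_dist_le _
    set T := {t : G | dist x₀' (t • x₀') ≤ 2 * D} with hT
    have := hfin.fintype
    -- all labels of a point of `X'` are obtained from one of them by right multiplication with `T`
    have hlabel : ∀ (x' : X') (g₀ g : G), dist x' (g₀ • x₀') ≤ D → dist x' (g • x₀') ≤ D →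
        ∃ t : T, g = g₀ * t := fun x' g₀ g h0 h1 => by
      refine ⟨⟨g₀⁻¹ * g, ?_⟩, by simp⟩
      change dist x₀' ((g₀⁻¹ * g) • x₀') ≤ 2 * D
      rw [← dist_smul g₀, smul_smul, mul_inv_cancel_left]
      linarith [dist_triangle_left (g₀ • x₀') (g • x₀') x']
    have hmain : ∀ x' y' z' p', p' ∈ C' x' y' → dist p' x' ≤ gromovProduct x' y' z' →
        ∃ a g h l : G, dist p' (a • x₀') ≤ D ∧ dist x' (g • x₀') ≤ D ∧ dist y' (h • x₀') ≤ D ∧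
          dist z' (l • x₀') ≤ D ∧ ∃ p ∈ C (g • x₀) (h • x₀), dist p (a • x₀) ≤ E ∧
            gromovProduct p (g • x₀) (l • x₀) ≤ M₃ + E := by
      intro x' y' z' p' hp' hle
      have h0 := hδ'.gromovProduct_le (hbetween x' y' p' hp') hle
      obtain ⟨a, g, h, h1, h2, h3, p, hp, h4⟩ := hp'
      obtain ⟨l, hl⟩ := hD z'
      refine ⟨a, g, h, l, h1, h2, h3, hl, p, hp, h4, ?_⟩
      have h5 := gromovProduct_le_add (a • x₀') (g • x₀') (l • x₀') p' x' z'
      rw [dist_comm _ p', dist_comm _ x', dist_comm _ z'] at h5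
      have h6 := hM₃ a g l (by linarith)
      have h7 := gromovProduct_le_add p (g • x₀) (l • x₀) (a • x₀) (g • x₀) (l • x₀)
      rw [dist_self, dist_self] at h7
      linarith
    choose c hc using hstab
    have e := Fintype.equivFin (T × T × T × Fin k)
    set R' := D + (B * (|E| + |R|) + B) with hR'
    refine ⟨Fintype.card (T × T × T × Fin k), max R' 0, le_max_right _ _, fun x' y' z' => ?_⟩
    obtain ⟨g₀, hg₀⟩ := hD x'
    obtain ⟨h₀, hh₀⟩ := hD y'
    obtain ⟨l₀, hl₀⟩ := hD z'
    refine ⟨fun i => f (c ((g₀ * (e.symm i).1) • x₀) ((h₀ * (e.symm i).2.1) • x₀)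
      ((l₀ * (e.symm i).2.2.1) • x₀) (e.symm i).2.2.2), ?_⟩
    -- outside of the balls in `X'`, the point `p` avoids the balls in `X`
    have hfar : ∀ (p' : X') (p : X) (a : G) (t₁ t₂ t₃ : T),
        (p' ∉ ⋃ i, Metric.closedBall (f (c ((g₀ * (e.symm i).1) • x₀)
          ((h₀ * (e.symm i).2.1) • x₀) ((l₀ * (e.symm i).2.2.1) • x₀) (e.symm i).2.2.2))
          (max R' 0)) → dist p' (a • x₀') ≤ D → dist p (a • x₀) ≤ E →
        ∀ i, R < dist p (c ((g₀ * t₁) • x₀) ((h₀ * t₂) • x₀) ((l₀ * t₃) • x₀) i) := by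
      intro p' p a t₁ t₂ t₃ hp' ha hp i
      by_contra! hle
      refine hp' (Set.mem_iUnion.2 ⟨e (t₁, t₂, t₃, i), ?_⟩)
      rw [Equiv.symm_apply_apply, Metric.mem_closedBall]
      refine le_trans ?_ (le_max_left _ _)
      set w := c ((g₀ * t₁) • x₀) ((h₀ * t₂) • x₀) ((l₀ * t₃) • x₀) i
      have h1 := hfx w a
      have h2 := dist_triangle_left w (a • x₀) p
      have h3 := mul_le_mul_of_nonneg_left
        (show dist w (a • x₀) ≤ |E| + |R| by linarith [le_abs_self E, le_abs_self R])
        (show 0 ≤ B by linarith)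
      have h4 := dist_triangle_right p' (f w) (a • x₀')
      linarith
    ext p'
    constructor
    · rintro ⟨⟨hp', hball⟩, hnot⟩
      refine ⟨⟨?_, hball⟩, hnot⟩
      obtain ⟨a, g, h, l, h1, h2, h3, h4, p, hp, h5, h6⟩ := hmain x' y' z' p' hp' hball
      obtain ⟨t₁, rfl⟩ := hlabel x' g₀ g hg₀ h2
      obtain ⟨t₂, rfl⟩ := hlabel y' h₀ h hh₀ h3
      obtain ⟨t₃, rfl⟩ := hlabel z' l₀ l hl₀ h4
      exact ⟨a, _, _, h1, h2, h4, p, (hc _ _ _ p (hfar p' p a t₁ t₂ t₃ hnot h1 h5)).1 hp h6, h5⟩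
    · rintro ⟨⟨hp', hball⟩, hnot⟩
      refine ⟨⟨?_, hball⟩, hnot⟩
      rw [Metric.mem_closedBall, gromovProduct_comm] at hball
      obtain ⟨a, g, l, h, h1, h2, h4, h3, p, hp, h5, h6⟩ := hmain x' z' y' p' hp' hball
      obtain ⟨t₁, rfl⟩ := hlabel x' g₀ g hg₀ h2
      obtain ⟨t₂, rfl⟩ := hlabel y' h₀ h hh₀ h3
      obtain ⟨t₃, rfl⟩ := hlabel z' l₀ l hl₀ h4
      exact ⟨a, _, _, h1, h2, h3, p, (hc _ _ _ p (hfar p' p a t₁ t₂ t₃ hnot h1 h5)).2 hp h6, h5⟩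

end Transfer

/-! ### Graphs are geodesic spaces -/

/-- There is a `1`-Lipschitz path from `x` to `y` parametrized by `[0, l]`. -/
def HasPathOfLength {X : Type u} [MetricSpace X] (x y : X) (l : ℝ) : Prop :=
  0 ≤ l ∧ ∃ γ : ℝ → X, γ 0 = x ∧ γ l = y ∧
    ∀ a b, 0 ≤ a → a ≤ b → b ≤ l → dist (γ a) (γ b) ≤ b - a

namespace HasPathOfLength

variable {X : Type u} [MetricSpace X] {x y z : X} {l m : ℝ}

theorem refl (x : X) : HasPathOfLength x x 0 :=
  ⟨le_rfl, fun _ => x, rfl, rfl, fun a b _ h _ => by simpa using h⟩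

theorem symm (h : HasPathOfLength x y l) : HasPathOfLength y x l := by
  obtain ⟨hl, γ, h0, h1, hγ⟩ := h
  refine ⟨hl, fun t => γ (l - t), by simp [h1], by simp [h0], fun a b ha hab hb => ?_⟩
  have := hγ (l - b) (l - a) (by linarith) (by linarith) (by linarith)
  rw [dist_comm]; linarith

theorem trans (h : HasPathOfLength x y l) (h' : HasPathOfLength y z m) :
    HasPathOfLength x z (l + m) := by
  obtain ⟨hl, γ, h0, h1, hγ⟩ := h
  obtain ⟨hm, γ', h0', h1', hγ'⟩ := h'
  refine ⟨by linarith, fun t => if t ≤ l then γ t else γ' (t - l), by simp [hl, h0], ?_,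
    fun a b ha hab hb => ?_⟩
  · by_cases hml : l + m ≤ l
    · have hm0 : m = 0 := by linarith
      subst hm0
      simp [h1, ← h1', h0']
    · simp only [if_neg hml]
      rw [add_sub_cancel_left, h1']
  · by_cases hbl : b ≤ l
    · simp only [if_pos hbl, if_pos (hab.trans hbl)]
      exact hγ a b ha hab hbl
    · by_cases hal : a ≤ l
      · simp only [if_neg hbl, if_pos hal]
        have e1 := hγ a l ha hal le_rfl
        have e2 := hγ' 0 (b - l) le_rfl (by linarith) (by linarith)
        rw [h1] at e1
        rw [h0'] at e2
        linarith [dist_triangle (γ a) y (γ' (b - l))]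
      · simp only [if_neg hbl, if_neg hal]
        have := hγ' (a - l) (b - l) (by linarith) (by linarith) (by linarith)
        linarith

theorem exists_isGeodesicSegment (h : HasPathOfLength x y (dist x y)) :
    ∃ s, IsGeodesicSegment x y s := by
  obtain ⟨-, γ, h0, h1, hγ⟩ := h
  have key : ∀ a b, 0 ≤ a → a ≤ b → b ≤ dist x y → dist (γ a) (γ b) = b - a := by
    intro a b ha hab hb
    refine le_antisymm (hγ a b ha hab hb) ?_
    have e1 := hγ 0 a le_rfl ha (hab.trans hb)
    have e2 := hγ b (dist x y) (ha.trans hab) hb le_rfl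
    rw [h0] at e1
    rw [h1] at e2
    linarith [dist_triangle4 x (γ a) (γ b) y]
  refine ⟨_, γ, h0, h1, fun a ha b hb => ?_, rfl⟩
  rcases le_total a b with h | h
  · rw [key a b ha.1 h hb.2, abs_sub_comm, abs_of_nonneg (by linarith)]
  · rw [dist_comm, key b a hb.1 h ha.2, abs_of_nonneg (by linarith)]

end HasPathOfLength

namespace ConnectedGraph

variable {Γ : ConnectedGraph.{u}}

/-- The point of the realization with a given name. -/
noncomputable abbrev toRealization (p : Γ.PrePoint) : Γ.Realization := SeparationQuotient.mk p

theorem mk_eq_mk_of_preDist_le {p q : Γ.PrePoint} (h : preDist p q ≤ 0) :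
    toRealization p = toRealization q := by
  rw [← dist_le_zero, SeparationQuotient.dist_mk]
  exact h

theorem mk_pt_symm (d : Γ.D) (t : unitInterval) :
    toRealization (.pt (Γ.rev d) (unitInterval.symm t)) = toRealization (.pt d t) := by
  refine (mk_eq_mk_of_preDist_le ?_).symm
  refine (preDist_le_of_alongEdge (AlongEdge.opp d t (unitInterval.symm t))).trans_eq ?_
  simp

theorem mk_pt_zero (d : Γ.D) : toRealization (.pt d 0) = toRealization (.vert (Γ.src d)) := by
  refine mk_eq_mk_of_preDist_le ?_
  refine (preDist_le_toVertex _ _ (Γ.src d)).trans ?_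
  simp [toVertex]

theorem mk_pt_one (d : Γ.D) :
    toRealization (.pt d 1) = toRealization (.vert (Γ.src (Γ.rev d))) := by
  rw [← mk_pt_zero, ← mk_pt_symm d 1, unitInterval.symm_one]

theorem hasPathOfLength_pt (d : Γ.D) (s t : unitInterval) :
    HasPathOfLength (toRealization (.pt d s)) (toRealization (.pt d t)) |(s : ℝ) - t| := by
  wlog h : s ≤ t generalizing s t
  · rw [abs_sub_comm]
    exact (this t s (le_of_not_ge h)).symm
  have h' : (s : ℝ) ≤ t := h
  rw [abs_sub_comm, abs_of_nonneg (by linarith)]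
  refine ⟨by linarith, fun u => toRealization (.pt d (Set.projIcc 0 1 zero_le_one (s + u))), ?_,
    ?_, fun a b ha hab hb => ?_⟩
  · simp only [add_zero, Set.projIcc_val]
  · simp only [add_sub_cancel, Set.projIcc_val]
  · rw [SeparationQuotient.dist_mk]
    refine (preDist_le_of_alongEdge (AlongEdge.same d _ _)).trans ?_
    have hs := s.2.1
    have ht := t.2.2
    rw [Set.projIcc_of_mem zero_le_one (x := (s : ℝ) + a) ⟨by linarith, by linarith⟩,
      Set.projIcc_of_mem zero_le_one (x := (s : ℝ) + b) ⟨by linarith, by linarith⟩,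
      add_sub_add_left_eq_sub, abs_sub_comm, abs_of_nonneg (by linarith)]

theorem hasPathOfLength_of_alongEdge {p q : Γ.PrePoint} {l : ℝ} (h : AlongEdge p q l) :
    HasPathOfLength (toRealization p) (toRealization q) l := by
  cases h with
  | same d s t => exact hasPathOfLength_pt d s t
  | opp d s t =>
    have h := hasPathOfLength_pt d s (unitInterval.symm t)
    rw [← mk_pt_symm d (unitInterval.symm t), unitInterval.symm_symm] at h
    exact h

theorem hasPathOfLength_src (d : Γ.D) :
    HasPathOfLength (toRealization (.vert (Γ.src d)))
      (toRealization (.vert (Γ.src (Γ.rev d)))) 1 := by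
  simpa [mk_pt_zero, mk_pt_one] using hasPathOfLength_pt d 0 1

theorem hasPathOfLength_walk {a b : Γ.V} (w : Γ.simple.Walk a b) :
    HasPathOfLength (toRealization (.vert a)) (toRealization (.vert b)) w.length := by
  induction w with
  | nil => simpa using HasPathOfLength.refl _
  | @cons a b c h w ih =>
    rw [simple, SimpleGraph.fromRel_adj] at h
    have hab : HasPathOfLength (toRealization (.vert a)) (toRealization (.vert b)) 1 := by
      rcases h.2 with ⟨d, rfl, rfl⟩ | ⟨d, rfl, rfl⟩
      · exact hasPathOfLength_src d
      · exact (hasPathOfLength_src d).symm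
    rw [SimpleGraph.Walk.length_cons, Nat.cast_add, Nat.cast_one, add_comm]
    exact hab.trans ih

theorem hasPathOfLength_vert (a b : Γ.V) :
    HasPathOfLength (toRealization (.vert a)) (toRealization (.vert b)) (Γ.simple.dist a b) := by
  obtain ⟨w, hw⟩ := simple_connected.exists_walk_length_eq_dist a b
  rw [← hw]
  exact hasPathOfLength_walk w

theorem hasPathOfLength_toVertex (p : Γ.PrePoint) (a : Γ.V) :
    HasPathOfLength (toRealization p) (toRealization (.vert a)) (toVertex p a) := by
  cases p with
  | vert b => exact hasPathOfLength_vert b a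
  | pt d t =>
    have h0 := t.2.1
    have h1 := t.2.2
    simp only [toVertex]
    rcases min_choice ((t : ℝ) + Γ.simple.dist (Γ.src d) a)
      (1 - (t : ℝ) + Γ.simple.dist (Γ.src (Γ.rev d)) a) with h | h <;> rw [h]
    · have h2 := hasPathOfLength_pt d t 0
      rw [mk_pt_zero, Set.Icc.coe_zero, sub_zero, abs_of_nonneg h0] at h2
      exact h2.trans (hasPathOfLength_vert _ a)
    · have h2 := hasPathOfLength_pt d t 1
      rw [mk_pt_one, Set.Icc.coe_one, abs_sub_comm, abs_of_nonneg (by linarith)] at h2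
      exact h2.trans (hasPathOfLength_vert _ a)

theorem isPWO_range_toVertex (p : Γ.PrePoint) : (Set.range (toVertex p)).IsPWO := by
  have key : ∀ c : ℝ, (Set.range fun n : ℕ => c + n).IsPWO := fun c => by
    rw [← Set.image_univ]
    refine (Set.isPWO_of_wellQuasiOrderedLE _).image_of_monotone fun m n h => ?_
    simpa using h
  cases p with
  | vert b =>
    refine (key 0).mono ?_
    rintro _ ⟨a, rfl⟩
    exact ⟨Γ.simple.dist b a, zero_add _⟩
  | pt d t =>
    refine ((key t).union (key (1 - t))).mono ?_
    rintro _ ⟨a, rfl⟩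
    simp only [toVertex]
    rcases min_choice ((t : ℝ) + Γ.simple.dist (Γ.src d) a)
      (1 - (t : ℝ) + Γ.simple.dist (Γ.src (Γ.rev d)) a) with h | h <;> rw [h]
    · exact Or.inl ⟨_, rfl⟩
    · exact Or.inr ⟨_, rfl⟩

theorem finite_setOf_alongEdge (p q : Γ.PrePoint) : {l | AlongEdge p q l}.Finite := by
  rcases p with b | ⟨d, s⟩
  · refine Set.finite_empty.subset ?_
    rintro l ⟨⟩
  rcases q with b | ⟨e, t⟩
  · refine Set.finite_empty.subset ?_
    rintro l ⟨⟩
  refine (Set.toFinite {|(s : ℝ) - t|, |(s : ℝ) - (1 - t)|}).subset ?_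
  rintro l ⟨⟩ <;> simp

/-- The infimum defining the distance is attained, because the lengths of paths through a vertex
form a well-ordered set. -/
theorem alongEdge_preDist_or (p q : Γ.PrePoint) :
    AlongEdge p q (preDist p q) ∨ ∃ a, preDist p q = toVertex p a + toVertex q a := by
  set S := {l | AlongEdge p q l ∨ ∃ a : Γ.V, l = toVertex p a + toVertex q a} with hS
  have hwf : S.IsWF := by
    refine Set.IsPWO.isWF (((finite_setOf_alongEdge p q).isPWO.union
      ((isPWO_range_toVertex p).add (isPWO_range_toVertex q))).mono ?_)
    rintro l (h | ⟨a, rfl⟩)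
    · exact Or.inl h
    · exact Or.inr (Set.add_mem_add ⟨a, rfl⟩ ⟨a, rfl⟩)
  obtain ⟨a⟩ := (simple_connected (Γ := Γ)).nonempty
  have hne : S.Nonempty := ⟨_, Or.inr ⟨a, rfl⟩⟩
  have hmin : IsLeast S (hwf.min hne) := ⟨hwf.min_mem hne, fun l hl => hwf.min_le hne hl⟩
  have : preDist p q ∈ S := by
    rw [preDist, hmin.csInf_eq]
    exact hmin.1
  exact this

variable (Γ) in
theorem isGeodesicSpace_realization : IsGeodesicSpace Γ.Realization := by
  intro x y
  obtain ⟨p, rfl⟩ := SeparationQuotient.surjective_mk x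
  obtain ⟨q, rfl⟩ := SeparationQuotient.surjective_mk y
  refine HasPathOfLength.exists_isGeodesicSegment ?_
  rw [SeparationQuotient.dist_mk]
  rcases alongEdge_preDist_or p q with h | ⟨a, h⟩
  · exact hasPathOfLength_of_alongEdge h
  · change HasPathOfLength _ _ (preDist p q)
    rw [h]
    exact (hasPathOfLength_toVertex p a).trans (hasPathOfLength_toVertex q a).symm

instance : Nonempty Γ.Realization :=
  (simple_connected (Γ := Γ)).nonempty.map fun a => toRealization (.vert a)

end ConnectedGraph

/-! ### Independence of the space and of its universe -/

section Independence

variable {G : Type u} [Group G]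

theorem IsHyperbolicGroup.admitsInvariantStableCylinders_of_admits (hG : IsHyperbolicGroup G)
    {X : Type v} [MetricSpace X] [MulAction G X] [IsIsometricSMul G X] [Nonempty X]
    {X' : Type w} [MetricSpace X'] [MulAction G X'] [IsIsometricSMul G X'] [Nonempty X']
    (hX : IsGeodesicSpace X) (hprop : ProperlyDiscontinuousSMul G X)
    (hcoc : IsCocompactAction G X)
    (hX' : IsGeodesicSpace X') (hprop' : ProperlyDiscontinuousSMul G X')
    (hcoc' : IsCocompactAction G X')
    (h : AdmitsInvariantStableCylinders G X) : AdmitsInvariantStableCylinders G X' := by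
  obtain ⟨x₀, D, hD, hlen⟩ := exists_displacementControlsLength hX hprop hcoc
  obtain ⟨x₀', D', hD', hlen'⟩ := exists_displacementControlsLength hX' hprop' hcoc'
  exact h.transfer hX hX' (hG.fourPointHyperbolic hX hD hlen) (hG.fourPointHyperbolic hX' hD' hlen')
    hD hD' hlen hlen'

/-- A space with a cocompact action of a countable group is separable, hence injects into
`ℕ → ℝ` and is small in every universe. -/
theorem IsCocompactAction.small [Countable G] {X : Type v} [MetricSpace X] [MulAction G X]
    [IsIsometricSMul G X] [Nonempty X] (h : IsCocompactAction G X) : Small.{w} X := by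
  obtain ⟨K, hK, hcov⟩ := h
  have hsep : TopologicalSpace.IsSeparable (Set.univ : Set X) := by
    rw [← hcov]
    exact TopologicalSpace.IsSeparable.iUnion fun g => (hK.smul g).isSeparable
  have := TopologicalSpace.isSeparable_univ_iff.1 hsep
  let u := TopologicalSpace.denseSeq X
  refine small_of_injective (f := fun (x : X) (n : ℕ) => dist x (u n)) fun x y hxy => ?_
  have h1 : (fun z => dist x z) = fun z => dist y z :=
    Continuous.ext_on (TopologicalSpace.denseRange_denseSeq X) (by fun_prop) (by fun_prop) (by
      rintro _ ⟨n, rfl⟩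
      exact congrFun hxy n)
  have h2 := congrFun h1 y
  rwa [dist_self, dist_eq_zero] at h2

theorem IsGeodesicSpace.of_isometryEquiv {X : Type v} [MetricSpace X] {Y : Type w} [MetricSpace Y]
    (h : IsGeodesicSpace X) (φ : X ≃ᵢ Y) : IsGeodesicSpace Y := by
  intro x y
  obtain ⟨-, γ, h0, h1, hγ, -⟩ := h (φ.symm x) (φ.symm y)
  rw [φ.symm.dist_eq] at h1 hγ
  refine ⟨_, φ ∘ γ, by simp [h0], by simp [h1], fun a ha b hb => ?_, rfl⟩
  rw [Function.comp_apply, Function.comp_apply, φ.dist_eq]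
  exact hγ a ha b hb

variable {X : Type v} [MetricSpace X] [MulAction G X] {Y : Type w} [MetricSpace Y] [MulAction G Y]

theorem properlyDiscontinuousSMul_of_isometryEquiv (h : ProperlyDiscontinuousSMul G X)
    (φ : X ≃ᵢ Y) (hφ : ∀ (g : G) (x : X), φ (g • x) = g • φ x) :
    ProperlyDiscontinuousSMul G Y where
  finite_disjoint_inter_image {K L} hK hL := by
    refine (h.finite_disjoint_inter_image (hK.image φ.symm.continuous)
      (hL.image φ.symm.continuous)).subset ?_
    rintro g ⟨_, ⟨k, hk, rfl⟩, hL⟩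
    refine ⟨φ.symm (g • k), ⟨φ.symm k, ⟨k, hk, rfl⟩, ?_⟩, ⟨_, hL, rfl⟩⟩
    apply φ.injective
    simp [hφ]

theorem IsCocompactAction.of_isometryEquiv (h : IsCocompactAction G X)
    (φ : X ≃ᵢ Y) (hφ : ∀ (g : G) (x : X), φ (g • x) = g • φ x) : IsCocompactAction G Y := by
  obtain ⟨K, hK, hcov⟩ := h
  refine ⟨φ '' K, hK.image φ.continuous, Set.eq_univ_of_forall fun y => ?_⟩
  obtain ⟨g, k, hk, hg⟩ := Set.mem_iUnion.1 (hcov.symm ▸ Set.mem_univ (φ.symm y) :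
    φ.symm y ∈ ⋃ g : G, g • K)
  refine Set.mem_iUnion.2 ⟨g, φ k, ⟨k, hk, rfl⟩, ?_⟩
  change g • φ k = y
  rw [← hφ, show g • k = φ.symm y from hg, IsometryEquiv.apply_symm_apply]

end Independence

theorem mainTheorem3 {G : Type u} [Group G] (hG : IsHyperbolicGroup G) :
    (∀ (Γ : ConnectedGraph.{v}) (Γ' : ConnectedGraph.{w}) [GraphAction G Γ] [GraphAction G Γ'],
      ProperlyDiscontinuousSMul G Γ.Realization → IsCocompactAction G Γ.Realization →
      ProperlyDiscontinuousSMul G Γ'.Realization → IsCocompactAction G Γ'.Realization →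
      (AdmitsInvariantStableCylinders G Γ.Realization ↔
        AdmitsInvariantStableCylinders G Γ'.Realization)) ∧
    (∀ (X : Type v) [MetricSpace X] [MulAction G X] [IsIsometricSMul G X] [Nonempty X],
      IsGeodesicSpace X → ProperlyDiscontinuousSMul G X → IsCocompactAction G X →
      (GroupAdmitsStableCylinders.{w} G ↔ AdmitsInvariantStableCylinders G X)) := by
  refine ⟨fun Γ Γ' _ _ hp hc hp' hc' => ?_, fun X _ _ _ _ hX hp hc => ⟨?_, fun hadm => ?_⟩⟩
  · have h := Γ.isGeodesicSpace_realization
    have h' := Γ'.isGeodesicSpace_realization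
    exact ⟨hG.admitsInvariantStableCylinders_of_admits h hp hc h' hp' hc',
      hG.admitsInvariantStableCylinders_of_admits h' hp' hc' h hp hc⟩
  · rintro ⟨Y, _, _, _, _, hY, -, hpY, hcY, hadm⟩
    exact hG.admitsInvariantStableCylinders_of_admits hY hpY hcY hX hp hc hadm
  · obtain ⟨x₀, D, hD, hlen⟩ := exists_displacementControlsLength hX hp hc
    have := hlen.countable
    have : Small.{w} X := hc.small
    -- `X` itself witnesses the claim, up to replacing it by a copy in the required universe
    let e : Shrink.{w} X ≃ X := (equivShrink X).symm
    let _ : MetricSpace (Shrink.{w} X) := MetricSpace.induced e e.injective inferInstance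
    let _ : MulAction G (Shrink.{w} X) := e.mulAction G
    let φ : X ≃ᵢ Shrink.{w} X :=
      IsometryEquiv.symm ⟨e, Isometry.of_dist_eq fun _ _ => rfl⟩
    have hφ : ∀ (g : G) (x : X), φ (g • x) = g • φ x := fun g x => by
      change e.symm (g • x) = e.symm (g • e (e.symm x))
      rw [Equiv.apply_symm_apply]
    have hiso : IsIsometricSMul G (Shrink.{w} X) := ⟨fun g => Isometry.of_dist_eq fun x y => by
      obtain ⟨x, rfl⟩ := φ.surjective x
      obtain ⟨y, rfl⟩ := φ.surjective y
      rw [← hφ, ← hφ, φ.dist_eq, φ.dist_eq, dist_smul]⟩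
    have hne : Nonempty (Shrink.{w} X) := ⟨φ x₀⟩
    have hY := hX.of_isometryEquiv φ
    have hpY := properlyDiscontinuousSMul_of_isometryEquiv hp φ hφ
    have hcY := hc.of_isometryEquiv φ hφ
    obtain ⟨δ, hδ⟩ := hG.fourPointHyperbolic hX hD hlen
    exact ⟨Shrink.{w} X, inferInstance, inferInstance, hiso, hne, hY,
      ⟨δ, fun x y z t => hδ (e x) (e y) (e z) (e t)⟩, hpY, hcY,
      hG.admitsInvariantStableCylinders_of_admits hX hp hc hY hpY hcY hadm⟩
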